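/- For $k\ge 1$ let $$\mathscr{G}_k(q):=\sum_{n_k\ge n_{k-1}\ge\cdots\ge n_1\ge 0} q^{\,n_k+\sum_{i=1}^{k-1}(2n_i^2+2n_i)}\,(q;q^2)_{n_k}\prod_{i=1}^{k-1}\begin{bmatrix} n_{i+1}\\ n_i\end{bmatrix}_{q^2},$$ where $(a;q)_n=\prod_{j=0}^{n-1}(1-aq^j)$ and $\begin{bmatrix} n\\ m\end{bmatrix}_{q}=\frac{(q;q)_n}{(q;q)_m\,(q;q)_{n-m}}$ is the $q$-binomial coefficient (a polynomial in $q$). After the substitution $q\mapsto 1-q$ the summand is divisible by $q^{n_k}$, so $\mathscr{G}_k(1-q)$ is a well-defined formal power series; write $\mathscr{G}_k(1-q)=\sum_{n\ge0}\xi_{\mathscr{G}_k}(n)q^n$. Then, for every fixed $k\ge 1$, as $n\to\infty$, $$\xi_{\mathscr{G}_k}(n)\sim \frac{\cos\left(\frac{\pi}{2(2k+1)}\right)2^{2n+2}\,n!}{\pi^{3/2}\sqrt{n}}\left(\frac{2k+1}{\pi^2}\right)^{n}e^{\frac{\pi^2}{8(2k+1)}}.$$ Moreover, $\xi_{\mathscr{G}_k}(n)>0$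 for all $n\ge 0$ and all $k\ge 1$. -/

import Mathlib

/-- The `q`-Pochhammer symbol `(a; q)_n = ∏_{j=0}^{n-1} (1 - a q^j)` in a commutative ring. -/
def qPochhammer {R : Type*} [CommRing R] (a q : R) (n : ℕ) : R :=
  ∏ j ∈ Finset.range n, (1 - a * q ^ j)

/-- The Gaussian (`q`-)binomial coefficient `[n, m]_q`, a polynomial in `q`, evaluated at an
element `q` of a commutative ring.  It is given by the `q`-Pascal rule so that it makes sense
without division; `qBinom_mul` shows that it is the usual quotient
`(q; q)_n / ((q; q)_m (q; q)_{n-m})`, and `qBinom_eq_zero` that it vanishes for `m > n`. -/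
def qBinom {R : Type*} [CommRing R] (q : R) : ℕ → ℕ → R
  | _, 0 => 1
  | 0, _ + 1 => 0
  | n + 1, m + 1 => qBinom q n m + q ^ (m + 1) * qBinom q n (m + 1)

theorem qBinom_eq_zero {R : Type*} [CommRing R] (q : R) :
    ∀ n m : ℕ, n < m → qBinom q n m = 0
  | 0, 0, h => absurd h (lt_irrefl 0)
  | 0, m + 1, _ => by simp [qBinom]
  | n + 1, 0, h => absurd h (Nat.not_lt_zero _)
  | n + 1, m + 1, h => by
    rw [qBinom, qBinom_eq_zero q n m (by omega), qBinom_eq_zero q n (m + 1) (by omega)]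
    simp

theorem qBinom_self {R : Type*} [CommRing R] (q : R) : ∀ n : ℕ, qBinom q n n = 1
  | 0 => by simp [qBinom]
  | n + 1 => by
    rw [qBinom, qBinom_self q n, qBinom_eq_zero q n (n + 1) (by omega)]
    simp

theorem qBinom_mul {R : Type*} [CommRing R] (q : R) :
    ∀ n m : ℕ, m ≤ n →
      qBinom q n m * (qPochhammer q q m * qPochhammer q q (n - m)) = qPochhammer q q n
  | n, 0, _ => by simp [qBinom, qPochhammer]
  | 0, m + 1, h => absurd h (Nat.not_succ_le_zero m)
  | n + 1, m + 1, h => by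
    rcases Nat.lt_or_ge m n with hmn | hmn
    · obtain ⟨l, rfl⟩ : ∃ l, n = m + 1 + l := ⟨n - (m + 1), by omega⟩
      have h1 := qBinom_mul q (m + 1 + l) m (by omega)
      have h2 := qBinom_mul q (m + 1 + l) (m + 1) (by omega)
      have e1 : m + 1 + l - m = l + 1 := by omega
      have e2 : m + 1 + l - (m + 1) = l := by omega
      have e3 : m + 1 + l + 1 - (m + 1) = l + 1 := by omega
      have p : ∀ i : ℕ, qPochhammer q q (i + 1) = qPochhammer q q i * (1 - q * q ^ i) :=
        fun i => Finset.prod_range_succ _ _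
      rw [e1] at h1
      rw [e2] at h2
      rw [e3, p (m + 1 + l), qBinom]
      rw [p l] at h1 ⊢
      rw [p m] at h2 ⊢
      linear_combination (1 - q * q ^ m) * h1 + q ^ (m + 1) * (1 - q * q ^ l) * h2
    · obtain rfl : m = n := by omega
      rw [qBinom_self]
      simp [qPochhammer]

/-- The entry `n_i` (`1 ≤ i ≤ k`) of a tuple `(n_1, …, n_k)`, which is stored as a function on
`Fin k = {0, …, k - 1}`. -/
def tupleEntry {k : ℕ} (ν : Fin k → ℕ) (i : ℕ) : ℕ :=
  if h : 1 ≤ i ∧ i ≤ k then ν ⟨i - 1, by omega⟩ else 0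

/-- The summand
`q^(n_k + ∑_{i=1}^{k-1} (2 n_i^2 + 2 n_i)) (q; q^2)_{n_k} ∏_{i=1}^{k-1} [n_{i+1}, n_i]_{q^2}`
belonging to the tuple `(n_1, …, n_k)`, evaluated at an element `q` of a commutative ring. -/
def gTerm {R : Type*} [CommRing R] {k : ℕ} (q : R) (ν : Fin k → ℕ) : R :=
  q ^ (tupleEntry ν k + ∑ i ∈ Finset.Ico 1 k, (2 * tupleEntry ν i ^ 2 + 2 * tupleEntry ν i)) *
    qPochhammer q (q ^ 2) (tupleEntry ν k) *
    ∏ i ∈ Finset.Ico 1 k, qBinom (q ^ 2) (tupleEntry ν (i + 1)) (tupleEntry ν i)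

/-- The formal power series `𝒢_k(1 - X)`: the sum over all tuples `n_1 ≤ n_2 ≤ … ≤ n_k` of the
summands at `q = 1 - X`.  The sum is taken coefficientwise; for each coefficient only
finitely many tuples contribute (`gTerm_coeff_finite`). -/
noncomputable def gSeries (k : ℕ) : PowerSeries ℤ :=
  PowerSeries.mk fun n =>
    ∑ᶠ ν : {ν : Fin k → ℕ // Monotone ν},
      PowerSeries.coeff n (gTerm (1 - PowerSeries.X : PowerSeries ℤ) ν.1)

/-- The coefficient `ξ_{𝒢_k}(n)` of `X^n` in `𝒢_k(1 - X)`. -/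
noncomputable def xiG (k n : ℕ) : ℤ :=
  PowerSeries.coeff n (gSeries k)

theorem X_pow_dvd_gTerm {k : ℕ} (ν : Fin k → ℕ) :
    (PowerSeries.X : PowerSeries ℤ) ^ tupleEntry ν k ∣
      gTerm (1 - PowerSeries.X : PowerSeries ℤ) ν := by
  unfold gTerm
  refine Dvd.dvd.mul_right (Dvd.dvd.mul_left ?_ _) _
  unfold qPochhammer
  have h := Finset.prod_dvd_prod_of_dvd (s := Finset.range (tupleEntry ν k))
    (fun _ : ℕ => (PowerSeries.X : PowerSeries ℤ))
    (fun j : ℕ => 1 - (1 - PowerSeries.X : PowerSeries ℤ) * ((1 - PowerSeries.X) ^ 2) ^ j) (by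
      intro j _
      have h := sub_dvd_pow_sub_pow (1 : PowerSeries ℤ) (1 - PowerSeries.X) (2 * j + 1)
      rw [sub_sub_cancel, one_pow, pow_succ', pow_mul] at h
      exact h)
  simpa using h

/-- For each `n`, only finitely many tuples contribute to the coefficient of `X^n`. -/
theorem gTerm_coeff_finite (k n : ℕ) :
    (Function.support fun ν : {ν : Fin k → ℕ // Monotone ν} =>
      PowerSeries.coeff n (gTerm (1 - PowerSeries.X : PowerSeries ℤ) ν.1)).Finite := by
  refine Set.Finite.subset
    (Set.Finite.preimage Subtype.val_injective.injOn
      (Set.finite_Iic (fun _ : Fin k => n))) ?_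
  rintro ⟨ν, hν⟩ hs
  rw [Function.mem_support] at hs
  rw [Set.mem_preimage, Set.mem_Iic]
  intro i
  by_contra hlt
  rw [not_le] at hlt
  have hi := i.isLt
  have hk : tupleEntry ν k = ν ⟨k - 1, by omega⟩ := by
    unfold tupleEntry
    rw [dif_pos ⟨by omega, le_refl k⟩]
  have hle : ν i ≤ tupleEntry ν k := by
    rw [hk]
    exact hν (Fin.mk_le_mk.mpr (by omega : i.1 ≤ k - 1))
  exact hs (PowerSeries.X_pow_dvd_iff.mp (X_pow_dvd_gTerm ν) n (lt_of_lt_of_le hlt hle))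

/-! The multisum is the value at `ρ = q`, base `q ^ 2`, of θ(ρ) = ∑ (ρ;q)_n ρ^n B_n, where B_n is a
`k`-fold Bailey iterate with `a = ρ ^ 2` (`sum_gTerm`). The contiguous relation of the iterates
makes θ satisfy θ(ρ) + ρ(ρ²q)^k θ(ρq) = 1 + ρ, up to a remainder that is small in the t-adic sense
(`thetaSum_functional_equation`).

Put ρ = e^(-mt), q = e^(-2t) and N = 2k+1. Then ρ ↦ ρq is the shift m ↦ m+2, and the equation has
exactly one solution among power series in t over polynomials in m. An explicit solution is a formal
Gaussian transform of e^(iN(m-1)x) cos x / cos(Nx) times the exponential of a quadratic in m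
(`formalTheta_functional_equation`). At m = 1 it becomes e^(k²t/N) times the transform of cos x /
cos(Nx) (`thetaExpansion`). Since e^(-t) = 1 - X for t = -log(1-X), ξ(n) is a convolution of the
coefficients of `thetaExpansion` with those of powers of -log(1-X)/X (`xiG_eq_convolution`).

Positivity: the logarithmic derivative N tan(Nx) - tan x has nonnegative coefficients, so every
factor in the convolution is nonnegative.

Asymptotics: the poles ±π/(2N) of cos x / cos(Nx) nearest to 0 determine its coefficients, and the
transform turns these into a multiple of r_n = (2n)!/n! κ^n with κ = N/π² (`growthSeq`). Dominated
convergence (`tendsto_convolution_div`) shows that e^(k²t/N) does not change the limit, while the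
substitution of the logarithm contributes ∑ (1/(8κ))^m/m! = e^(π²/(8N)). Stirling's formula
finishes. -/

/-! ### Elementary rules for q-binomials and q-Pochhammer symbols -/

theorem qBinom_zero_right {R : Type*} [CommRing R] (q : R) (n : ℕ) : qBinom q n 0 = 1 := by
  cases n <;> rfl

theorem qBinom_succ_succ {R : Type*} [CommRing R] (q : R) (n m : ℕ) :
    qBinom q (n + 1) (m + 1) = qBinom q n m + q ^ (m + 1) * qBinom q n (m + 1) := rfl

/-- The second `q`-Pascal rule. -/
theorem qBinom_succ_succ' {R : Type*} [CommRing R] (q : R) (n : ℕ) :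
    ∀ m ≤ n, qBinom q (n + 1) (m + 1) = qBinom q n (m + 1) + q ^ (n - m) * qBinom q n m := by
  induction n with
  | zero =>
    intro m hm
    obtain rfl : m = 0 := by omega
    simp [qBinom]
  | succ n ih =>
    intro m hm
    rcases m with _ | r
    · rw [qBinom_succ_succ q (n + 1) 0, ih 0 (by omega), qBinom_zero_right, qBinom_zero_right]
      have h := ih 0 (by omega)
      rw [qBinom_succ_succ q n 0, qBinom_zero_right] at h
      simp only [Nat.sub_zero, zero_add, pow_one] at h ⊢
      linear_combination h
    · rcases Nat.lt_or_ge r n with hr | hr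
      · obtain ⟨l, rfl⟩ : ∃ l, n = r + 1 + l := ⟨n - (r + 1), by omega⟩
        have h1 := ih r (by omega)
        have h2 := ih (r + 1) (by omega)
        have h3 := qBinom_succ_succ q (r + 1 + l) (r + 1)
        have h4 := qBinom_succ_succ q (r + 1 + l) r
        rw [qBinom_succ_succ q (r + 1 + l + 1) (r + 1)]
        have e1 : r + 1 + l - r = l + 1 := by omega
        have e2 : r + 1 + l - (r + 1) = l := by omega
        have e3 : r + 1 + l + 1 - (r + 1) = l + 1 := by omega
        rw [e1] at h1
        rw [e2] at h2
        rw [e3]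
        linear_combination h1 + q ^ (r + 2) * h2 - h3 - q ^ (l + 1) * h4
      · obtain rfl : r = n := by omega
        rw [qBinom_self, qBinom_self, qBinom_eq_zero q (r + 1) (r + 1 + 1) (by omega)]
        simp

theorem qPochhammer_succ {R : Type*} [CommRing R] (a q : R) (n : ℕ) :
    qPochhammer a q (n + 1) = qPochhammer a q n * (1 - a * q ^ n) :=
  Finset.prod_range_succ _ _

theorem qPochhammer_succ' {R : Type*} [CommRing R] (a q : R) (n : ℕ) :
    qPochhammer a q (n + 1) = (1 - a) * qPochhammer (a * q) q n := by
  unfold qPochhammer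
  rw [Finset.prod_range_succ', mul_comm, pow_zero, mul_one]
  congr 1
  exact Finset.prod_congr rfl fun j _ => by rw [pow_succ']; ring

theorem map_qPochhammer {R S : Type*} [CommRing R] [CommRing S] (f : R →+* S) (a q : R) (n : ℕ) :
    f (qPochhammer a q n) = qPochhammer (f a) (f q) n := by
  simp [qPochhammer, map_prod]

theorem map_qBinom {R S : Type*} [CommRing R] [CommRing S] (f : R →+* S) (q : R) :
    ∀ n m : ℕ, f (qBinom q n m) = qBinom (f q) n m
  | n, 0 => by simp [qBinom_zero_right]
  | 0, _ + 1 => by simp [qBinom]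
  | n + 1, m + 1 => by simp [qBinom_succ_succ, map_qBinom f q n]

/-! ### The Bailey chain and the functional equation of the theta sum -/

/-- The result of applying the step `B_n ↦ ∑_r a^r q^(r^2) [n, r]_q B_r` of the Bailey chain
`k` times to the sequence `1, 0, 0, …`. -/
def baileyIterate {R : Type*} [CommRing R] (a q : R) : ℕ → ℕ → R
  | 0, n => if n = 0 then 1 else 0
  | k + 1, n => ∑ r ∈ Finset.range (n + 1), a ^ r * q ^ r ^ 2 * qBinom q n r * baileyIterate a q k r

theorem map_baileyIterate {R S : Type*} [CommRing R] [CommRing S] (f : R →+* S) (a q : R)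
    (k : ℕ) : ∀ n, f (baileyIterate a q k n) = baileyIterate (f a) (f q) k n := by
  induction k with
  | zero => intro n; simp [baileyIterate, apply_ite f]
  | succ k ih => intro n; simp [baileyIterate, map_sum, map_qBinom, ih]

theorem baileyIterate_zero_right {R : Type*} [CommRing R] (a q : R) (k : ℕ) :
    baileyIterate a q k 0 = 1 := by
  induction k with
  | zero => simp [baileyIterate]
  | succ k ih => simp [baileyIterate, ih, qBinom_zero_right]

/-- The operator B ↦ (1 - aq^(n+1)) B_(n+1) - B_n passes through a Bailey step. The new weight a^r
q^(r²+r), times the q^r that the previous step supplies, is the weight for the parameter `a * q ^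
2`; this drives the induction on `k` in the contiguous relation. -/
theorem bailey_step_difference {R : Type*} [CommRing R] (a q : R) (B : ℕ → R) (n : ℕ) :
    (1 - a * q ^ (n + 1)) *
        (∑ r ∈ Finset.range (n + 2), a ^ r * q ^ r ^ 2 * qBinom q (n + 1) r * B r) -
      ∑ r ∈ Finset.range (n + 1), a ^ r * q ^ r ^ 2 * qBinom q n r * B r =
    a * q ^ (n + 1) * ∑ r ∈ Finset.range (n + 1),
      a ^ r * q ^ (r ^ 2 + r) * qBinom q n r * ((1 - a * q ^ (r + 1)) * B (r + 1) - B r) := by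
  have e : ∑ r ∈ Finset.range (n + 1), a ^ r * q ^ r ^ 2 * qBinom q n r * B r =
      ∑ r ∈ Finset.range (n + 2), a ^ r * q ^ r ^ 2 * qBinom q n r * B r := by
    rw [Finset.sum_range_succ _ (n + 1), qBinom_eq_zero q n (n + 1) (by omega)]
    simp
  have e' : ∑ r ∈ Finset.range (n + 1), a ^ r * q ^ (r ^ 2 + r) * qBinom q n r * B r =
      ∑ r ∈ Finset.range (n + 2), a ^ r * q ^ (r ^ 2 + r) * qBinom q n r * B r := by
    rw [Finset.sum_range_succ _ (n + 1), qBinom_eq_zero q n (n + 1) (by omega)]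
    simp
  have s : ∑ r ∈ Finset.range (n + 1),
      a ^ r * q ^ (r ^ 2 + r) * qBinom q n r * ((1 - a * q ^ (r + 1)) * B (r + 1) - B r) =
      (∑ r ∈ Finset.range (n + 1),
        a ^ r * q ^ (r ^ 2 + r) * qBinom q n r * ((1 - a * q ^ (r + 1)) * B (r + 1))) -
      ∑ r ∈ Finset.range (n + 1), a ^ r * q ^ (r ^ 2 + r) * qBinom q n r * B r := by
    rw [← Finset.sum_sub_distrib]
    exact Finset.sum_congr rfl fun r _ => by ring
  rw [s, e', e, mul_sub, sub_eq_iff_eq_add, Finset.mul_sum, Finset.mul_sum, Finset.mul_sum,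
    Finset.sum_range_succ' _ (n + 1), Finset.sum_range_succ' (fun r => a * q ^ (n + 1) * _) (n + 1),
    Finset.sum_range_succ' (fun r => a ^ r * q ^ r ^ 2 * qBinom q n r * B r) (n + 1)]
  have key : ∀ r ∈ Finset.range (n + 1),
      (1 - a * q ^ (n + 1)) *
        (a ^ (r + 1) * q ^ (r + 1) ^ 2 * qBinom q (n + 1) (r + 1) * B (r + 1)) =
      a * q ^ (n + 1) * (a ^ r * q ^ (r ^ 2 + r) * qBinom q n r *
        ((1 - a * q ^ (r + 1)) * B (r + 1))) -
      a * q ^ (n + 1) * (a ^ (r + 1) * q ^ ((r + 1) ^ 2 + (r + 1)) * qBinom q n (r + 1) *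
        B (r + 1)) +
      a ^ (r + 1) * q ^ (r + 1) ^ 2 * qBinom q n (r + 1) * B (r + 1) := by
    intro r hr
    rw [Finset.mem_range] at hr
    obtain ⟨l, rfl⟩ : ∃ l, n = r + l := ⟨n - r, by omega⟩
    have h1 := qBinom_succ_succ' q (r + l) r (by omega)
    have h2 := qBinom_succ_succ q (r + l) r
    rw [Nat.add_sub_cancel_left] at h1
    -- The two summands of 1 - aq^(n+1) use different Pascal rules: the second rule for 1, the first
    -- for aq^(n+1).
    linear_combination a ^ (r + 1) * q ^ (r + 1) ^ 2 * B (r + 1) * h1 -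
      a * q ^ (r + l + 1) * a ^ (r + 1) * q ^ (r + 1) ^ 2 * B (r + 1) * h2
  rw [Finset.sum_congr rfl key, Finset.sum_add_distrib, Finset.sum_sub_distrib]
  simp only [qBinom_zero_right]
  ring

/-- The contiguous relation between the parameters `a` and `a q^2`. -/
theorem baileyIterate_recurrence {R : Type*} [CommRing R] (a q : R) (k : ℕ) :
    ∀ n, (1 - a * q ^ (n + 1)) * baileyIterate a q k (n + 1) - baileyIterate a q k n =
      -((a * q) ^ k * q ^ n * baileyIterate (a * q ^ 2) q k n) := by
  induction k with
  | zero =>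
    intro n
    rcases n with _ | n <;> simp [baileyIterate]
  | succ k ih =>
    intro n
    rw [baileyIterate, baileyIterate, bailey_step_difference, baileyIterate, Finset.mul_sum,
      Finset.mul_sum, ← Finset.sum_neg_distrib]
    refine Finset.sum_congr rfl fun r _ => ?_
    rw [ih r]
    ring

/-- The partial sum `∑_{n < M} (ρ; q)_n ρ^n B_n`, with `B_n` the `k`-fold Bailey iterate for
`a = ρ^2`. -/
def thetaSum {R : Type*} [CommRing R] (k : ℕ) (ρ q : R) (M : ℕ) : R :=
  ∑ n ∈ Finset.range M, qPochhammer ρ q n * ρ ^ n * baileyIterate (ρ ^ 2) q k n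

theorem map_thetaSum {R S : Type*} [CommRing R] [CommRing S] (f : R →+* S) (k : ℕ) (ρ q : R)
    (M : ℕ) : f (thetaSum k ρ q M) = thetaSum k (f ρ) (f q) M := by
  simp [thetaSum, map_sum, map_qPochhammer, map_baileyIterate]

/-- The first-order `q`-difference equation of a partial theta function, with a remainder. -/
theorem thetaSum_functional_equation {R : Type*} [CommRing R] (k : ℕ) (ρ q : R) (M : ℕ) :
    thetaSum k ρ q (M + 1) + ρ * (ρ ^ 2 * q) ^ k * thetaSum k (ρ * q) q (M + 1) =
      1 + ρ - qPochhammer (ρ * q) q M * ρ ^ (M + 1) *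
        ((1 - ρ ^ 2 * q ^ (M + 1)) * baileyIterate (ρ ^ 2) q k (M + 1)) := by
  induction M with
  | zero =>
    have h := baileyIterate_recurrence (ρ ^ 2) q k 0
    simp only [baileyIterate_zero_right] at h
    simp only [thetaSum, zero_add, Finset.sum_range_one, baileyIterate_zero_right]
    simp only [qPochhammer, Finset.range_zero, Finset.prod_empty]
    linear_combination ρ * h
  | succ M ih =>
    have h := baileyIterate_recurrence (ρ ^ 2) q k (M + 1)
    have e : (ρ * q) ^ 2 = ρ ^ 2 * q ^ 2 := by ring
    unfold thetaSum at ih ⊢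
    rw [Finset.sum_range_succ _ (M + 1), Finset.sum_range_succ _ (M + 1)]
    rw [e] at ih ⊢
    rw [qPochhammer_succ' ρ, qPochhammer_succ (ρ * q)]
    linear_combination ih + qPochhammer (ρ * q) q M * (1 - ρ * q * q ^ M) * ρ ^ (M + 2) * h

/-! ### Exponential series and the formal Gaussian transform -/

open PowerSeries in
/-- The power series `exp (c X)`. -/
noncomputable def expSeries {A : Type*} [CommRing A] [Algebra ℚ A] (c : A) : PowerSeries A :=
  rescale c (exp A)

section ExpSeries

open PowerSeries

variable {A : Type*} [CommRing A] [Algebra ℚ A]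

theorem expSeries_mul (a b : A) : expSeries a * expSeries b = expSeries (a + b) :=
  exp_mul_exp_eq_exp_add a b

theorem expSeries_zero : expSeries (0 : A) = 1 := by
  simp [expSeries]

theorem expSeries_pow (a : A) (n : ℕ) : expSeries a ^ n = expSeries (n * a) := by
  induction n with
  | zero => simp [expSeries_zero]
  | succ n ih => rw [pow_succ, ih, expSeries_mul]; congr 1; push_cast; ring

theorem constantCoeff_expSeries (a : A) : constantCoeff (expSeries a) = 1 := by
  rw [← coeff_zero_eq_constantCoeff_apply, expSeries, coeff_rescale]
  simp

theorem coeff_expSeries (a : A) (n : ℕ) :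
    coeff n (expSeries a) = a ^ n * algebraMap ℚ A (1 / n.factorial) := by
  rw [expSeries, coeff_rescale, coeff_exp]

theorem map_expSeries {B : Type*} [CommRing B] [Algebra ℚ B] (f : A →+* B) (a : A) :
    map f (expSeries a) = expSeries (f a) := by
  ext n
  rw [coeff_map, coeff_expSeries, coeff_expSeries, map_mul, map_pow, RingHom.map_rat_algebraMap]

/-- The formal Gaussian transform, which maps `exp (b X)` to `exp (c b^2 X)`. -/
noncomputable def gaussTransform (c : A) (g : PowerSeries A) : PowerSeries A :=
  mk fun j => algebraMap ℚ A ((2 * j).factorial / j.factorial) * c ^ j * coeff (2 * j) g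

theorem gaussTransform_add (c : A) (g h : PowerSeries A) :
    gaussTransform c (g + h) = gaussTransform c g + gaussTransform c h := by
  ext j; simp [gaussTransform, mul_add]

/-- Formally the transform is the expectation of g(Z√(2cX)) for a standard normal Z, whose even
moments are (2j)!/(2^j j!). On an exponential the factor (2j)! cancels. -/
theorem gaussTransform_expSeries (c b : A) :
    gaussTransform c (expSeries b) = expSeries (c * b ^ 2) := by
  ext j
  rw [gaussTransform, coeff_mk, coeff_expSeries, coeff_expSeries, mul_pow, ← pow_mul]
  have h : algebraMap ℚ A ((2 * j).factorial / j.factorial) *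
      algebraMap ℚ A (1 / (2 * j).factorial) = algebraMap ℚ A (1 / j.factorial) := by
    rw [← map_mul]
    congr 1
    have := Nat.cast_ne_zero (R := ℚ).2 (2 * j).factorial_ne_zero
    field_simp
  rw [← h]
  ring

theorem map_gaussTransform {B : Type*} [CommRing B] [Algebra ℚ B] (f : A →+* B) (c : A)
    (g : PowerSeries A) : map f (gaussTransform c g) = gaussTransform (f c) (map f g) := by
  ext n
  simp only [gaussTransform, coeff_map, coeff_mk, map_mul, map_pow, RingHom.map_rat_algebraMap]

theorem X_pow_dvd_qPochhammer_expSeries (a b : A) (n : ℕ) :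
    (X : PowerSeries A) ^ n ∣ qPochhammer (expSeries a) (expSeries b) n := by
  unfold qPochhammer
  have h := Finset.prod_dvd_prod_of_dvd (s := Finset.range n) (fun _ : ℕ => (X : PowerSeries A))
    (fun j : ℕ => 1 - expSeries a * expSeries b ^ j) (by
      intro j _
      rw [X_dvd_iff]
      simp [constantCoeff_expSeries])
  simpa using h

end ExpSeries

/-! ### The series cos X / cos(NX) -/

/-- The formal power series `cos X / cos (N X)`. -/
noncomputable def cosRatio {K : Type*} [Field K] [Algebra ℚ K] (N : K) : PowerSeries K :=
  PowerSeries.cos K * (PowerSeries.rescale N (PowerSeries.cos K))⁻¹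

section CosRatio

open PowerSeries

variable {K : Type*} [Field K] [Algebra ℚ K]

theorem constantCoeff_rescale_cos (N : K) : constantCoeff (rescale N (cos K)) = 1 := by
  rw [← coeff_zero_eq_constantCoeff_apply, coeff_rescale]
  simp [cos]

theorem cosRatio_mul_cos (N : K) : cosRatio N * rescale N (cos K) = cos K := by
  rw [cosRatio, mul_assoc, PowerSeries.inv_mul_cancel _ (by simp [constantCoeff_rescale_cos]),
    mul_one]

theorem rescale_cos_ne_zero (N : K) : rescale N (cos K) ≠ 0 := by
  intro h
  have := constantCoeff_rescale_cos N
  simp [h] at this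

theorem map_rescale {A B : Type*} [CommRing A] [CommRing B] (f : A →+* B) (c : A)
    (g : PowerSeries A) : map f (rescale c g) = rescale (f c) (map f g) := by
  ext n; simp [coeff_rescale]

theorem map_cosRatio {L : Type*} [Field L] [Algebra ℚ L] (f : K →+* L) (N : K) :
    map f (cosRatio N) = cosRatio (f N) := by
  have h := congrArg (map f) (cosRatio_mul_cos N)
  rw [map_mul, map_rescale, map_cos] at h
  exact mul_right_cancel₀ (rescale_cos_ne_zero _) (h.trans (cosRatio_mul_cos (f N)).symm)

end CosRatio

/-! ### Uniqueness for the difference equation in m -/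

section Uniqueness

open PowerSeries

/-- The substitution `m ↦ m + 2` on polynomials in `m`. -/
noncomputable def shiftTwo : Polynomial ℂ →+* Polynomial ℂ :=
  Polynomial.compRingHom (Polynomial.X + Polynomial.C 2)

/-- A shift preserves the leading coefficient, which would thus equal its own negative. -/
theorem eq_zero_of_add_shiftTwo_eq_zero (p : Polynomial ℂ) (h : p + shiftTwo p = 0) : p = 0 := by
  have h1 : (p.comp (Polynomial.X + Polynomial.C 2)).leadingCoeff = p.leadingCoeff := by
    rw [Polynomial.leadingCoeff_comp (by simp), Polynomial.leadingCoeff_X_add_C, one_pow, mul_one]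
  have h2 : p.comp (Polynomial.X + Polynomial.C 2) = -p := by
    rw [eq_neg_iff_add_eq_zero, add_comm]; exact h
  rw [h2, Polynomial.leadingCoeff_neg] at h1
  exact Polynomial.leadingCoeff_eq_zero.1 (self_eq_neg.1 h1.symm)

/-- Once the lower coefficients of `D` vanish, the next one satisfies d(m) + d(m+2) = 0, because `g`
starts with 1. -/
theorem X_pow_dvd_of_dvd_add_mul_shiftTwo (D g : PowerSeries (Polynomial ℂ))
    (hg : constantCoeff g = 1) (M : ℕ) (h : X ^ M ∣ D + g * map shiftTwo D) : X ^ M ∣ D := by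
  rw [X_pow_dvd_iff] at h ⊢
  intro n
  induction n using Nat.strong_induction_on with
  | _ n ih =>
    intro hn
    have h1 := h n hn
    rw [map_add, coeff_mul, Finset.sum_eq_single (0, n)] at h1
    · rw [coeff_zero_eq_constantCoeff_apply, hg, one_mul, coeff_map] at h1
      exact eq_zero_of_add_shiftTwo_eq_zero _ h1
    · rintro ⟨i, j⟩ hij hne
      have hij := Finset.HasAntidiagonal.mem_antidiagonal.1 hij
      rw [coeff_map, ih j (by grind) (by grind), map_zero, mul_zero]
    · simp

end Uniqueness

/-! ### The explicit solution and its specialization at m = 1 -/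

section FormalTheta

open PowerSeries

/-- The asymptotic expansion of the partial theta function: a formal power series in `t` over the
polynomials in `m`, for `ρ = exp (-m t)`, `q = exp (-2 t)`. -/
noncomputable def formalTheta (N : ℂ) : PowerSeries (Polynomial ℂ) :=
  expSeries (Polynomial.C (1 / (4 * N)) * (Polynomial.C N * Polynomial.X - 1) ^ 2) *
    gaussTransform (Polynomial.C (1 / (4 * N)))
      (expSeries (Polynomial.C (Complex.I * N) * (Polynomial.X - 1)) *
        map Polynomial.C (cosRatio N))

theorem two_mul_cos : 2 * cos ℂ = expSeries Complex.I + expSeries (-Complex.I) := by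
  ext n
  have h2 : (2 : PowerSeries ℂ) = C 2 := (map_ofNat C 2).symm
  rw [h2, coeff_C_mul, map_add, coeff_expSeries, coeff_expSeries, cos, coeff_mk]
  rcases Nat.even_or_odd n with hn | hn
  · rw [if_pos hn, hn.neg_pow]
    obtain ⟨j, rfl⟩ := hn
    rw [← two_mul, pow_mul, Complex.I_sq, Nat.mul_div_cancel_left _ (by norm_num)]
    simp
    ring
  · rw [if_neg (Nat.not_even_iff_odd.2 hn), hn.neg_pow]
    ring

theorem rescale_expSeries {A : Type*} [CommRing A] [Algebra ℚ A] (a b : A) :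
    rescale a (expSeries b) = expSeries (a * b) := by
  rw [expSeries, expSeries, rescale_rescale, mul_comm]

theorem cosRatio_mul_expSeries (N : ℂ) :
    cosRatio N * (expSeries (Complex.I * N) + expSeries (-(Complex.I * N))) =
      expSeries Complex.I + expSeries (-Complex.I) := by
  have h : expSeries (Complex.I * N) + expSeries (-(Complex.I * N)) = 2 * rescale N (cos ℂ) := by
    have := congrArg (rescale N) two_mul_cos
    rw [map_add, rescale_expSeries, rescale_expSeries, map_mul, map_ofNat] at this
    rw [this, mul_comm, mul_neg]
  rw [h, ← two_mul_cos, mul_left_comm, cosRatio_mul_cos]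

theorem shiftTwo_C (c : ℂ) : shiftTwo (Polynomial.C c) = Polynomial.C c := by
  simp [shiftTwo]

theorem shiftTwo_X : shiftTwo Polynomial.X = Polynomial.X + Polynomial.C 2 := by
  simp [shiftTwo]

/-- The quadratic prefactor is chosen so that its shift absorbs the coefficient of the equation.
Under the transform there remains e^(iN(m-1)x) + e^(iN(m+1)x) = 2cos(Nx) e^(iNmx), which cancels the
denominator and leaves two exponentials. Their Gaussian transforms combine with the prefactor to 1
and e^(-mt). -/
theorem formalTheta_functional_equation (N : ℂ) (hN : N ≠ 0) :
    formalTheta N + expSeries (-(Polynomial.C N * Polynomial.X + Polynomial.C (N - 1))) *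
      map shiftTwo (formalTheta N) = 1 + expSeries (-Polynomial.X) := by
  have hmap : map shiftTwo (map Polynomial.C (cosRatio N)) = map Polynomial.C (cosRatio N) := by
    ext1 n
    simp only [coeff_map, shiftTwo_C]
  have hc : Polynomial.C (1 / (4 * N)) * Polynomial.C N * 4 = 1 := by
    rw [← Polynomial.C_mul, show (4 : Polynomial ℂ) = Polynomial.C 4 from rfl, ← Polynomial.C_mul,
      ← Polynomial.C_1]
    congr 1
    field_simp
  have hI : (Polynomial.C Complex.I : Polynomial ℂ) ^ 2 = -1 := by
    rw [← Polynomial.C_pow, Complex.I_sq]; simp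
  have hsum : expSeries (Polynomial.C (Complex.I * N) * (Polynomial.X - 1)) *
        map Polynomial.C (cosRatio N) +
      expSeries (Polynomial.C (Complex.I * N) * (Polynomial.X + 1)) *
        map Polynomial.C (cosRatio N) =
      expSeries (Polynomial.C Complex.I * (Polynomial.C N * Polynomial.X + 1)) +
      expSeries (Polynomial.C Complex.I * (Polynomial.C N * Polynomial.X - 1)) := by
    have h := congrArg (map (Polynomial.C : ℂ →+* Polynomial ℂ)) (cosRatio_mul_expSeries N)
    rw [map_mul, map_add, map_add, map_expSeries, map_expSeries, map_expSeries, map_expSeries] at h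
    have e1 : expSeries (Polynomial.C (Complex.I * N) * (Polynomial.X - 1)) =
        expSeries (Polynomial.C (Complex.I * N) * Polynomial.X) *
          expSeries (Polynomial.C (-(Complex.I * N))) := by
      rw [expSeries_mul, Polynomial.C_neg]; congr 1; ring
    have e2 : expSeries (Polynomial.C (Complex.I * N) * (Polynomial.X + 1)) =
        expSeries (Polynomial.C (Complex.I * N) * Polynomial.X) *
          expSeries (Polynomial.C (Complex.I * N)) := by
      rw [expSeries_mul]; congr 1; ring
    have e3 : expSeries (Polynomial.C Complex.I * (Polynomial.C N * Polynomial.X + 1)) =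
        expSeries (Polynomial.C (Complex.I * N) * Polynomial.X) *
          expSeries (Polynomial.C Complex.I) := by
      rw [expSeries_mul, Polynomial.C_mul]; congr 1; ring
    have e4 : expSeries (Polynomial.C Complex.I * (Polynomial.C N * Polynomial.X - 1)) =
        expSeries (Polynomial.C (Complex.I * N) * Polynomial.X) *
          expSeries (Polynomial.C (-Complex.I)) := by
      rw [expSeries_mul, Polynomial.C_mul, Polynomial.C_neg]; congr 1; ring
    rw [e1, e2, e3, e4]
    linear_combination expSeries (Polynomial.C (Complex.I * N) * Polynomial.X) * h
  have hshift : map shiftTwo (formalTheta N) =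
      expSeries (Polynomial.C (1 / (4 * N)) *
        (Polynomial.C N * (Polynomial.X + Polynomial.C 2) - 1) ^ 2) *
      gaussTransform (Polynomial.C (1 / (4 * N)))
        (expSeries (Polynomial.C (Complex.I * N) * (Polynomial.X + 1)) *
          map Polynomial.C (cosRatio N)) := by
    unfold formalTheta
    rw [map_mul, map_gaussTransform, map_mul, map_expSeries, map_expSeries, hmap]
    simp only [map_mul, map_sub, map_pow, map_one, shiftTwo_C, shiftTwo_X]
    have e : (Polynomial.X + Polynomial.C 2 - 1 : Polynomial ℂ) = Polynomial.X + 1 := by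
      have : (Polynomial.C 2 : Polynomial ℂ) = 2 := rfl
      rw [this]; ring
    rw [e]
  rw [hshift, ← mul_assoc, expSeries_mul]
  have e5 : -(Polynomial.C N * Polynomial.X + Polynomial.C (N - 1)) +
      Polynomial.C (1 / (4 * N)) * (Polynomial.C N * (Polynomial.X + Polynomial.C 2) - 1) ^ 2 =
      Polynomial.C (1 / (4 * N)) * (Polynomial.C N * Polynomial.X - 1) ^ 2 := by
    have : (Polynomial.C 2 : Polynomial ℂ) = 2 := rfl
    rw [this, Polynomial.C_sub, Polynomial.C_1]
    linear_combination (Polynomial.C N * Polynomial.X + Polynomial.C N - 1) * hc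
  rw [e5, formalTheta, ← mul_add, ← gaussTransform_add, hsum, gaussTransform_add,
    gaussTransform_expSeries, gaussTransform_expSeries, mul_add, expSeries_mul, expSeries_mul,
    add_comm]
  have e6 : Polynomial.C (1 / (4 * N)) * (Polynomial.C N * Polynomial.X - 1) ^ 2 +
      Polynomial.C (1 / (4 * N)) *
        (Polynomial.C Complex.I * (Polynomial.C N * Polynomial.X - 1)) ^ 2 = 0 := by
    rw [mul_pow, hI]; ring
  have e7 : Polynomial.C (1 / (4 * N)) * (Polynomial.C N * Polynomial.X - 1) ^ 2 +
      Polynomial.C (1 / (4 * N)) *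
        (Polynomial.C Complex.I * (Polynomial.C N * Polynomial.X + 1)) ^ 2 = -Polynomial.X := by
    rw [mul_pow, hI]
    linear_combination -Polynomial.X * hc
  rw [e6, e7, expSeries_zero]

/-- Both series satisfy the same equation up to a remainder containing (ρq;q)_M, each of whose `M`
factors is divisible by `X`; uniqueness modulo `X ^ M` applies. -/
theorem X_pow_dvd_thetaSum_sub_formalTheta (k M : ℕ) :
    (X : PowerSeries (Polynomial ℂ)) ^ M ∣
      thetaSum k (expSeries (-Polynomial.X)) (expSeries (-Polynomial.C 2)) (M + 1) -
        formalTheta (2 * (k : ℂ) + 1) := by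
  set ρ : PowerSeries (Polynomial ℂ) := expSeries (-Polynomial.X)
  set q : PowerSeries (Polynomial ℂ) := expSeries (-Polynomial.C 2) with hq
  have hρ : ρ * q = map shiftTwo ρ := by
    rw [expSeries_mul, map_expSeries, map_neg, shiftTwo_X]; congr 1; ring
  have hq' : map shiftTwo q = q := by
    rw [hq, map_expSeries, map_neg, shiftTwo_C]
  -- This is where N = 2k+1 comes from: the exponent is -((2k+1)m + 2k)t.
  have hg : ρ * (ρ ^ 2 * q) ^ k = expSeries
      (-(Polynomial.C (2 * (k : ℂ) + 1) * Polynomial.X + Polynomial.C (2 * (k : ℂ) + 1 - 1))) := by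
    simp only [ρ, q, expSeries_pow, expSeries_mul]
    congr 1
    simp
    have : (Polynomial.C 2 : Polynomial ℂ) = 2 := rfl
    rw [this]; ring
  have h1 := thetaSum_functional_equation k ρ q M
  have h2 := formalTheta_functional_equation (2 * k + 1) (by norm_cast)
  rw [← hg] at h2
  refine X_pow_dvd_of_dvd_add_mul_shiftTwo _ (ρ * (ρ ^ 2 * q) ^ k) ?_ M ?_
  · simp [ρ, q, constantCoeff_expSeries]
  · rw [map_sub, map_thetaSum (map shiftTwo), hq', ← hρ]
    have e : thetaSum k ρ q (M + 1) - formalTheta (2 * (k : ℂ) + 1) + ρ * (ρ ^ 2 * q) ^ k *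
        (thetaSum k (ρ * q) q (M + 1) - map shiftTwo (formalTheta (2 * (k : ℂ) + 1))) =
        -(qPochhammer (ρ * q) q M * (ρ ^ (M + 1) *
        ((1 - ρ ^ 2 * q ^ (M + 1)) * baileyIterate (ρ ^ 2) q k (M + 1)))) := by
      linear_combination h1 - h2
    rw [e, dvd_neg, expSeries_mul]
    exact (X_pow_dvd_qPochhammer_expSeries _ _ M).mul_right _

/-- The expansion of the theta sum at `ρ = exp (-t)`, `q = exp (-2 t)`. -/
noncomputable def thetaExpansion (k : ℕ) : PowerSeries ℝ :=
  expSeries ((k : ℝ) ^ 2 / (2 * k + 1)) *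
    gaussTransform (1 / (4 * (2 * (k : ℝ) + 1))) (cosRatio (2 * (k : ℝ) + 1))

theorem X_pow_dvd_thetaSum_sub_thetaExpansion (k M : ℕ) :
    (X : PowerSeries ℝ) ^ M ∣
      thetaSum k (expSeries (-1 : ℝ)) (expSeries (-1 : ℝ) ^ 2) (M + 1) - thetaExpansion k := by
  have h := map_dvd (map (Polynomial.evalRingHom (1 : ℂ))) (X_pow_dvd_thetaSum_sub_formalTheta k M)
  have hk : (2 * (k : ℂ) + 1) ≠ 0 := by norm_cast
  have e1 : map (Polynomial.evalRingHom (1 : ℂ)) (formalTheta (2 * (k : ℂ) + 1)) =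
      map Complex.ofRealHom (thetaExpansion k) := by
    rw [formalTheta, thetaExpansion, map_mul (map Complex.ofRealHom), map_mul, map_gaussTransform,
      map_gaussTransform, map_mul (map _) (expSeries _) (map _ _), map_expSeries, map_expSeries, map_expSeries, map_cosRatio]
    have : map (Polynomial.evalRingHom (1 : ℂ)) (map Polynomial.C (cosRatio (2 * (k : ℂ) + 1))) =
        cosRatio (2 * (k : ℂ) + 1) := by
      ext n; simp
    rw [this]
    simp [expSeries_zero]
    -- What remains is (N-1)²/(4N) = k²/N for N = 2k+1.
    left
    congr 1
    field_simp
    ring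
  have e2 : map (Polynomial.evalRingHom (1 : ℂ)) (thetaSum k (expSeries (-Polynomial.X))
      (expSeries (-Polynomial.C 2)) (M + 1)) =
      map Complex.ofRealHom
        (thetaSum k (expSeries (-1 : ℝ)) (expSeries (-1 : ℝ) ^ 2) (M + 1)) := by
    rw [map_thetaSum, map_thetaSum, map_pow, map_expSeries, map_expSeries, map_expSeries,
      expSeries_pow]
    simp
  rw [map_sub, e1, e2, ← map_sub, map_pow, map_X, X_pow_dvd_iff] at h
  rw [X_pow_dvd_iff]
  intro n hn
  have := h n hn
  rw [coeff_map] at this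
  exact Complex.ofReal_eq_zero.1 this

end FormalTheta

/-! ### The multisum as an iterated Bailey sum -/

theorem tupleEntry_of_mem {k : ℕ} (ν : Fin k → ℕ) {i : ℕ} (h : 1 ≤ i ∧ i ≤ k) :
    tupleEntry ν i = ν ⟨i - 1, by omega⟩ := dif_pos h

/-- The part of `gTerm` that does not depend on the last entry alone. -/
def chainWeight {R : Type*} [CommRing R] {k : ℕ} (q : R) (ν : Fin k → ℕ) : R :=
  ∏ i ∈ Finset.Ico 1 k, q ^ (2 * tupleEntry ν i ^ 2 + 2 * tupleEntry ν i) *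
    qBinom (q ^ 2) (tupleEntry ν (i + 1)) (tupleEntry ν i)

theorem gTerm_eq {R : Type*} [CommRing R] {k : ℕ} (q : R) (ν : Fin k → ℕ) :
    gTerm q ν = qPochhammer q (q ^ 2) (tupleEntry ν k) * q ^ tupleEntry ν k * chainWeight q ν := by
  rw [gTerm, chainWeight, Finset.prod_mul_distrib, pow_add, Finset.prod_pow_eq_pow_sum]
  ring

/-- A descent makes one q-binomial vanish, so the monotonicity constraint can be dropped from the
sum. -/
theorem gTerm_eq_zero_of_not_monotone {R : Type*} [CommRing R] {k : ℕ} (q : R) (ν : Fin k → ℕ)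
    (h : ¬ Monotone ν) : gTerm q ν = 0 := by
  rcases k with _ | k
  · exact absurd (fun i => i.elim0) h
  rw [Fin.monotone_iff_le_succ] at h
  push Not at h
  obtain ⟨i, hi⟩ := h
  have := i.isLt
  rw [gTerm, Finset.prod_eq_zero (i := (i : ℕ) + 1), mul_zero]
  · rw [Finset.mem_Ico]; omega
  · rw [tupleEntry_of_mem _ (by omega), tupleEntry_of_mem _ (by omega)]
    exact qBinom_eq_zero _ _ _ hi

theorem tupleEntry_snoc_of_le {k : ℕ} (ν : Fin k → ℕ) (n i : ℕ) (hi : i ≤ k) :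
    tupleEntry (Fin.snoc ν n : Fin (k + 1) → ℕ) i = tupleEntry ν i := by
  by_cases h : 1 ≤ i
  · rw [tupleEntry_of_mem _ ⟨h, by omega⟩, tupleEntry_of_mem _ ⟨h, hi⟩]
    exact Fin.snoc_castSucc (α := fun _ => ℕ) n ν ⟨i - 1, by omega⟩
  · simp [tupleEntry, h]

theorem tupleEntry_snoc_last {k : ℕ} (ν : Fin k → ℕ) (n : ℕ) :
    tupleEntry (Fin.snoc ν n : Fin (k + 1) → ℕ) (k + 1) = n := by
  rw [tupleEntry_of_mem _ ⟨by omega, le_rfl⟩]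
  exact Fin.snoc_last (α := fun _ => ℕ) n ν

theorem chainWeight_snoc {R : Type*} [CommRing R] {k : ℕ} (q : R) (ν : Fin (k + 1) → ℕ) (n : ℕ) :
    chainWeight q (Fin.snoc ν n : Fin (k + 2) → ℕ) =
      q ^ (2 * tupleEntry ν (k + 1) ^ 2 + 2 * tupleEntry ν (k + 1)) *
        qBinom (q ^ 2) n (tupleEntry ν (k + 1)) * chainWeight q ν := by
  rw [chainWeight, Finset.prod_Ico_succ_top (by omega), tupleEntry_snoc_last,
    tupleEntry_snoc_of_le _ _ _ le_rfl, mul_comm, chainWeight]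
  congr 1
  refine Finset.prod_congr rfl fun i hi => ?_
  rw [Finset.mem_Ico] at hi
  rw [tupleEntry_snoc_of_le _ _ _ (by omega), tupleEntry_snoc_of_le _ _ _ (by omega)]

/-- Splitting off the last entry leaves a shorter sum whose new last entry carries an extra weight;
the arbitrary `g` absorbs that weight in the induction. The weight q^(2s²+2s) is that of a Bailey
step with parameter and base both `q ^ 2`. -/
theorem sum_chainWeight {R : Type*} [CommRing R] (q : R) (M k : ℕ) :
    ∀ g : ℕ → R, ∑ ν : Fin (k + 1) → Fin M,
        g (tupleEntry (fun i => (ν i : ℕ)) (k + 1)) * chainWeight q (fun i => (ν i : ℕ)) =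
      ∑ n ∈ Finset.range M, g n * baileyIterate (q ^ 2) (q ^ 2) (k + 1) n := by
  induction k with
  | zero =>
    intro g
    rw [← (Equiv.funUnique (Fin 1) (Fin M)).symm.sum_comp, ← Fin.sum_univ_eq_sum_range
      (fun n => g n * baileyIterate (q ^ 2) (q ^ 2) (0 + 1) n)]
    refine Finset.sum_congr rfl fun n _ => ?_
    -- The first step applied to 1, 0, 0, … gives the constant sequence 1, so `k` entries match `k`
    -- steps although only `k - 1` of them carry weights.
    have : baileyIterate (q ^ 2) (q ^ 2) (0 + 1) n = 1 := by
      rw [baileyIterate, Finset.sum_eq_single 0]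
      · simp [baileyIterate, qBinom_zero_right]
      · intro b _ hb; simp [baileyIterate, hb]
      · simp
    rw [this]
    simp [tupleEntry, chainWeight]
  | succ k ih =>
    intro g
    rw [← (Fin.snocEquiv (fun _ : Fin (k + 2) => Fin M)).sum_comp, Fintype.sum_prod_type,
      ← Fin.sum_univ_eq_sum_range
        (fun n => g n * baileyIterate (q ^ 2) (q ^ 2) (k + 1 + 1) n)]
    refine Finset.sum_congr rfl fun n _ => ?_
    have hs : ∀ ν : Fin (k + 1) → Fin M,
        (fun i => ((Fin.snocEquiv (fun _ : Fin (k + 2) => Fin M) (n, ν) i : Fin M) : ℕ)) =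
        (Fin.snoc (fun i => (ν i : ℕ)) (n : ℕ) : Fin (k + 2) → ℕ) := by
      intro ν
      funext i
      refine Fin.lastCases ?_ (fun i => ?_) i
      · simp [Fin.snocEquiv]
      · simp [Fin.snocEquiv]
    have h := ih fun s => q ^ (2 * s ^ 2 + 2 * s) * qBinom (q ^ 2) n s
    rw [baileyIterate]
    have e : ∑ s ∈ Finset.range M, q ^ (2 * s ^ 2 + 2 * s) * qBinom (q ^ 2) n s *
        baileyIterate (q ^ 2) (q ^ 2) (k + 1) s =
        ∑ r ∈ Finset.range (n + 1), (q ^ 2) ^ r * (q ^ 2) ^ r ^ 2 * qBinom (q ^ 2) n r *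
          baileyIterate (q ^ 2) (q ^ 2) (k + 1) r := by
      symm
      refine Finset.sum_subset_zero_on_sdiff ?_ ?_ ?_
      · exact Finset.range_subset_range.2 n.isLt
      · intro s hs
        rw [Finset.mem_sdiff, Finset.mem_range, Finset.mem_range] at hs
        rw [qBinom_eq_zero _ _ _ (by omega)]
        simp
      · intro s _
        ring
    rw [← e, ← h, Finset.mul_sum]
    refine Finset.sum_congr rfl fun ν _ => ?_
    rw [hs, tupleEntry_snoc_last, chainWeight_snoc]

theorem sum_gTerm {R : Type*} [CommRing R] (q : R) (M k : ℕ) (hk : 1 ≤ k) :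
    ∑ ν : Fin k → Fin M, gTerm q (fun i => (ν i : ℕ)) = thetaSum k q (q ^ 2) M := by
  obtain ⟨k, rfl⟩ : ∃ l, k = l + 1 := ⟨k - 1, by omega⟩
  simp only [gTerm_eq]
  exact sum_chainWeight q M k fun n => qPochhammer q (q ^ 2) n * q ^ n

open PowerSeries in
theorem le_of_coeff_gTerm_ne_zero {k n : ℕ} (ν : Fin k → ℕ)
    (h : coeff n (gTerm (1 - X : PowerSeries ℤ) ν) ≠ 0) (i : Fin k) : ν i ≤ n := by
  by_contra hlt
  rw [not_le] at hlt
  have hi := i.isLt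
  have hν : Monotone ν := by
    by_contra hν
    rw [gTerm_eq_zero_of_not_monotone _ _ hν] at h
    simp at h
  have hle : ν i ≤ tupleEntry ν k := by
    rw [tupleEntry_of_mem _ ⟨by omega, le_rfl⟩]
    exact hν (Fin.mk_le_mk.mpr (by omega : i.1 ≤ k - 1))
  exact h (X_pow_dvd_iff.mp (X_pow_dvd_gTerm ν) n (lt_of_lt_of_le hlt hle))

open PowerSeries in
theorem xiG_eq_coeff_thetaSum (k n M : ℕ) (hk : 1 ≤ k) (hn : n < M) :
    xiG k n = coeff n (thetaSum k (1 - X : PowerSeries ℤ) ((1 - X) ^ 2) M) := by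
  rw [xiG, gSeries, coeff_mk, ← sum_gTerm _ _ _ hk, map_sum]
  let e : (Fin k → Fin M) ↪ (Fin k → ℕ) :=
    ⟨fun ν i => (ν i : ℕ), fun ν μ h => funext fun i => Fin.ext (congrFun h i)⟩
  have h1 : ∑ᶠ ν : {ν : Fin k → ℕ // Monotone ν}, coeff n (gTerm (1 - X : PowerSeries ℤ) ν.1) =
      ∑ᶠ ν : Fin k → ℕ, coeff n (gTerm (1 - X : PowerSeries ℤ) ν) := by
    rw [finsum_subtype_eq_finsum_cond
      (f := fun ν : Fin k → ℕ => coeff n (gTerm (1 - X : PowerSeries ℤ) ν)) Monotone]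
    refine finsum_congr fun ν => ?_
    by_cases hν : Monotone ν
    · simp [hν]
    · simp [hν, gTerm_eq_zero_of_not_monotone]
  rw [h1, finsum_eq_sum_of_support_subset (s := Finset.univ.map e), Finset.sum_map]
  · rfl
  · intro ν hν
    have := le_of_coeff_gTerm_ne_zero ν hν
    rw [Finset.coe_map, Finset.coe_univ, Set.image_univ]
    exact ⟨fun i => ⟨ν i, lt_of_le_of_lt (this i) hn⟩, rfl⟩

/-! ### The substitution t = -log(1-X) -/

section NegLog

open PowerSeries

/-- The power series `-log (1 - X) / X`. -/
noncomputable def negLogDivX : PowerSeries ℝ := mk fun n => ((n : ℝ) + 1)⁻¹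

/-- The formal power series `-log (1 - X)`. -/
noncomputable def negLog : PowerSeries ℝ := X * negLogDivX

theorem hasSubst_negLog : HasSubst negLog :=
  HasSubst.of_constantCoeff_zero' (by simp [negLog])

theorem derivative_negLog : d⁄dX ℝ negLog = mk 1 := by
  ext n
  rw [coeff_derivative, negLog, coeff_succ_X_mul, negLogDivX, coeff_mk, coeff_mk]
  simp
  field_simp

theorem derivative_expSeries (c : ℝ) : d⁄dX ℝ (expSeries c) = C c * expSeries c := by
  ext n
  rw [coeff_derivative, coeff_C_mul, coeff_expSeries, coeff_expSeries, Nat.factorial_succ, pow_succ']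
  simp
  field_simp

theorem X_pow_dvd_negLog_pow (j : ℕ) : (X : PowerSeries ℝ) ^ j ∣ negLog ^ j :=
  pow_dvd_pow_of_dvd (Dvd.intro _ rfl) j

theorem coeff_subst_negLog (g : PowerSeries ℝ) (n : ℕ) :
    coeff n (g.subst negLog) = ∑ j ∈ Finset.range (n + 1), coeff j g * coeff n (negLog ^ j) := by
  rw [coeff_subst' hasSubst_negLog, finsum_eq_sum_of_support_subset]
  · rfl
  · intro j hj
    rw [Finset.coe_range, Set.mem_Iio]
    by_contra hlt
    exact hj (by simp only; rw [X_pow_dvd_iff.1 (X_pow_dvd_negLog_pow j) n (by omega), smul_zero])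

/-- The left side y satisfies y' = -y/(1-X), so y/(1-X) has derivative 0 and constant term 1. -/
theorem subst_negLog_expSeries : (expSeries (-1 : ℝ)).subst negLog = 1 - X := by
  set y := (expSeries (-1 : ℝ)).subst negLog with hy
  have hd : d⁄dX ℝ y = -(y * mk 1) := by
    rw [hy, derivative_subst hasSubst_negLog, derivative_expSeries, derivative_negLog,
      subst_mul hasSubst_negLog]
    have : (C (-1 : ℝ)).subst negLog = (-1 : PowerSeries ℝ) := by
      rw [← coe_substAlgHom hasSubst_negLog]; simp
    rw [this]; ring
  have hone : (mk 1 : PowerSeries ℝ) * (1 - X) = 1 := mk_one_mul_one_sub_eq_one ℝ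
  have hd1 : d⁄dX ℝ (mk 1 : PowerSeries ℝ) = mk 1 * mk 1 := by
    have h := congrArg (d⁄dX ℝ) hone
    rw [Derivation.leibniz, map_sub, Derivation.map_one_eq_zero, derivative_X] at h
    simp only [smul_eq_mul] at h
    linear_combination (mk 1 : PowerSeries ℝ) * h - d⁄dX ℝ (mk 1 : PowerSeries ℝ) * hone
  have hz : y * mk 1 = 1 := by
    apply derivative.ext
    · rw [Derivation.leibniz, hd, hd1]
      simp only [smul_eq_mul]
      rw [Derivation.map_one_eq_zero]
      ring
    · rw [map_mul, hy, ← coeff_zero_eq_constantCoeff_apply, coeff_subst_negLog]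
      rw [zero_add, Finset.sum_range_one, coeff_expSeries, pow_zero]
      simp
  linear_combination (1 - X) * hz - y * hone

theorem xiG_eq_sum (k n : ℕ) (hk : 1 ≤ k) :
    (xiG k n : ℝ) =
      ∑ j ∈ Finset.range (n + 1), coeff j (thetaExpansion k) * coeff n (negLog ^ j) := by
  -- With `n + 2` terms the error is divisible by `X ^ (n + 1)`, hence invisible in degree `n`.
  rw [← coeff_subst_negLog, xiG_eq_coeff_thetaSum k n (n + 2) hk (by omega)]
  have h := map_dvd (substAlgHom hasSubst_negLog) (X_pow_dvd_thetaSum_sub_thetaExpansion k (n + 1))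
  rw [map_pow, map_sub] at h
  have e1 : substAlgHom hasSubst_negLog (thetaSum k (expSeries (-1 : ℝ))
      (expSeries (-1 : ℝ) ^ 2) (n + 1 + 1)) =
      map (Int.castRingHom ℝ) (thetaSum k (1 - X : PowerSeries ℤ) ((1 - X) ^ 2) (n + 2)) := by
    have h1 := map_thetaSum (substAlgHom (S := ℝ) (R := ℝ) hasSubst_negLog).toRingHom k
      (expSeries (-1 : ℝ)) (expSeries (-1 : ℝ) ^ 2) (n + 2)
    have h2 : (substAlgHom (S := ℝ) (R := ℝ) hasSubst_negLog).toRingHom (expSeries (-1 : ℝ)) =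
        1 - X := by
      rw [← subst_negLog_expSeries, ← coe_substAlgHom hasSubst_negLog]; rfl
    rw [map_pow, h2] at h1
    rw [map_thetaSum]
    simpa using h1
  rw [e1, substAlgHom_X] at h
  have h3 := X_pow_dvd_iff.1 ((X_pow_dvd_negLog_pow (n + 1)).trans h) n (by omega)
  rw [map_sub, coeff_map, sub_eq_zero, coe_substAlgHom] at h3
  simpa using h3

theorem coeff_negLog_pow (j m : ℕ) :
    coeff (m + j) (negLog ^ j) = coeff m (negLogDivX ^ j) := by
  rw [negLog, mul_pow, coeff_X_pow_mul]

end NegLog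

/-! ### Positivity of the coefficients of cos X / cos(NX) -/

section CosRatioCoefficients

open PowerSeries

theorem derivative_rescale {R : Type*} [CommRing R] (a : R) (g : PowerSeries R) :
    d⁄dX R (rescale a g) = C a * rescale a (d⁄dX R g) := by
  ext n
  rw [coeff_derivative, coeff_C_mul, coeff_rescale, coeff_rescale, coeff_derivative]
  ring

theorem derivative_cos : d⁄dX ℝ (cos ℝ) = -sin ℝ := by
  ext n
  rw [coeff_derivative, map_neg, cos, sin, coeff_mk, coeff_mk]
  rcases Nat.even_or_odd' n with ⟨m, rfl | rfl⟩
  · simp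
  · have h1 : Even (2 * m + 1 + 1) := ⟨m + 1, by ring⟩
    have h2 : ¬ Even (2 * m + 1) := by simp
    rw [if_pos h1, if_neg h2, show (2 * m + 1 + 1) / 2 = m + 1 by omega,
      show (2 * m + 1) / 2 = m by omega, Nat.factorial_succ (2 * m + 1), pow_succ]
    simp
    field_simp

theorem derivative_sin : d⁄dX ℝ (sin ℝ) = cos ℝ := by
  ext n
  rw [coeff_derivative, cos, sin, coeff_mk, coeff_mk]
  rcases Nat.even_or_odd' n with ⟨m, rfl | rfl⟩
  · have h1 : ¬ Even (2 * m + 1) := by simp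
    have h2 : Even (2 * m) := by simp
    rw [if_neg h1, if_pos h2, show (2 * m + 1) / 2 = m by omega,
      show (2 * m) / 2 = m by omega, Nat.factorial_succ (2 * m)]
    simp
    field_simp
  · have h1 : Even (2 * m + 1 + 1) := ⟨m + 1, by ring⟩
    have h2 : ¬ Even (2 * m + 1) := by simp
    rw [if_pos h1, if_neg h2]
    simp

theorem constantCoeff_cos : constantCoeff (cos ℝ) = 1 := by
  rw [← coeff_zero_eq_constantCoeff_apply]
  simp [cos]

theorem cos_ne_zero : cos ℝ ≠ 0 := by
  intro h
  have := constantCoeff_cos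
  simp [h] at this

/-- The formal power series of the tangent. -/
noncomputable def tanSeries : PowerSeries ℝ := sin ℝ * (cos ℝ)⁻¹

theorem tanSeries_mul_cos : tanSeries * cos ℝ = sin ℝ := by
  rw [tanSeries, mul_assoc, PowerSeries.inv_mul_cancel _ (by simp [constantCoeff_cos]), mul_one]

theorem derivative_tanSeries : d⁄dX ℝ tanSeries = 1 + tanSeries * tanSeries := by
  have h := congrArg (d⁄dX ℝ) tanSeries_mul_cos
  rw [Derivation.leibniz, derivative_cos, derivative_sin, ← tanSeries_mul_cos] at h
  simp only [smul_eq_mul] at h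
  refine mul_right_cancel₀ cos_ne_zero ?_
  linear_combination h

theorem coeff_zero_tanSeries : coeff 0 tanSeries = 0 := by
  simp [tanSeries, sin]

theorem coeff_one_tanSeries : coeff 1 tanSeries = 1 := by
  have h := congrArg (coeff 0) derivative_tanSeries
  rw [coeff_derivative, map_add, coeff_mul] at h
  simpa [coeff_zero_tanSeries, -coeff_zero_eq_constantCoeff] using h

/-- The Riccati equation tan' = 1 + tan² is a recursion with nonnegative terms. -/
theorem coeff_tanSeries_nonneg (n : ℕ) : 0 ≤ coeff n tanSeries := by
  induction n using Nat.strong_induction_on with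
  | _ n ih =>
    rcases n with _ | n
    · rw [coeff_zero_tanSeries]
    · have h := congrArg (coeff n) derivative_tanSeries
      rw [coeff_derivative, map_add, coeff_mul, coeff_one] at h
      have h1 : 0 ≤ ∑ p ∈ Finset.HasAntidiagonal.antidiagonal n,
          coeff p.1 tanSeries * coeff p.2 tanSeries := by
        refine Finset.sum_nonneg fun p hp => ?_
        have := Finset.HasAntidiagonal.mem_antidiagonal.1 hp
        exact mul_nonneg (ih _ (by omega)) (ih _ (by omega))
      have h2 : (0 : ℝ) ≤ if n = 0 then 1 else 0 := by split_ifs <;> norm_num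
      have h3 : 0 ≤ coeff (n + 1) tanSeries * (n + 1) := by rw [h]; exact add_nonneg h2 h1
      exact nonneg_of_mul_nonneg_left h3 (by positivity)

/-- The logarithmic derivative of `cos X / cos (N X)`. -/
theorem derivative_cosRatio (N : ℝ) :
    d⁄dX ℝ (cosRatio N) = cosRatio N * (C N * rescale N tanSeries - tanSeries) := by
  have h := congrArg (d⁄dX ℝ) (cosRatio_mul_cos N)
  rw [Derivation.leibniz, derivative_rescale, derivative_cos] at h
  simp only [smul_eq_mul] at h
  refine mul_right_cancel₀ (rescale_cos_ne_zero N) ?_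
  have h1 := congrArg (rescale N) tanSeries_mul_cos
  rw [map_mul] at h1
  rw [map_neg] at h
  linear_combination h - cosRatio N * C N * h1 + tanSeries_mul_cos +
    tanSeries * cosRatio_mul_cos N

theorem coeff_zero_cosRatio (N : ℝ) : coeff 0 (cosRatio N) = 1 := by
  simp [cosRatio, constantCoeff_rescale_cos, constantCoeff_cos]

theorem coeff_odd_cosRatio (N : ℝ) (j : ℕ) : coeff (2 * j + 1) (cosRatio N) = 0 := by
  have hc : rescale (-1 : ℝ) (cos ℝ) = cos ℝ := by
    ext n
    rw [coeff_rescale, cos, coeff_mk]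
    split_ifs with h
    · rw [h.neg_one_pow, one_mul]
    · simp
  have h := congrArg (rescale (-1 : ℝ)) (cosRatio_mul_cos N)
  rw [map_mul, rescale_rescale, mul_comm N, ← rescale_rescale, hc] at h
  have h1 := mul_right_cancel₀ (rescale_cos_ne_zero N) (h.trans (cosRatio_mul_cos N).symm)
  have h2 := congrArg (coeff (2 * j + 1)) h1
  rw [coeff_rescale, Odd.neg_one_pow (by simp)] at h2
  linarith

theorem coeff_logDeriv_nonneg {N : ℝ} (hN : 1 < N) (n : ℕ) :
    0 ≤ coeff n (C N * rescale N tanSeries - tanSeries) := by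
  rw [map_sub, coeff_C_mul, coeff_rescale, ← mul_assoc, ← pow_succ', ← sub_one_mul]
  exact mul_nonneg (sub_nonneg.2 (one_le_pow₀ hN.le)) (coeff_tanSeries_nonneg n)

theorem coeff_succ_cosRatio (N : ℝ) (n : ℕ) :
    coeff (n + 1) (cosRatio N) * (n + 1) = ∑ p ∈ Finset.HasAntidiagonal.antidiagonal n,
      coeff p.1 (cosRatio N) * coeff p.2 (C N * rescale N tanSeries - tanSeries) := by
  rw [← coeff_mul, ← derivative_cosRatio, coeff_derivative]

theorem coeff_cosRatio_nonneg {N : ℝ} (hN : 1 < N) (n : ℕ) : 0 ≤ coeff n (cosRatio N) := by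
  induction n using Nat.strong_induction_on with
  | _ n ih =>
    rcases n with _ | n
    · rw [coeff_zero_cosRatio]; exact zero_le_one
    · have h1 : 0 ≤ coeff (n + 1) (cosRatio N) * (n + 1) := by
        rw [coeff_succ_cosRatio]
        refine Finset.sum_nonneg fun p hp => ?_
        have := Finset.HasAntidiagonal.mem_antidiagonal.1 hp
        exact mul_nonneg (ih _ (by omega)) (coeff_logDeriv_nonneg hN _)
      exact nonneg_of_mul_nonneg_left h1 (by positivity)

theorem coeff_even_cosRatio_pos {N : ℝ} (hN : 1 < N) (j : ℕ) :
    0 < coeff (2 * j) (cosRatio N) := by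
  induction j with
  | zero => rw [mul_zero, coeff_zero_cosRatio]; exact one_pos
  | succ j ih =>
    have h1 : 0 < coeff (2 * j + 1 + 1) (cosRatio N) * ((2 * j + 1 : ℕ) + 1) := by
      rw [coeff_succ_cosRatio]
      -- The strictly positive summand pairs degree `2 * j` with the linear coefficient N² - 1 of
      -- the logarithmic derivative.
      refine Finset.sum_pos' (fun p _ => mul_nonneg (coeff_cosRatio_nonneg hN _)
        (coeff_logDeriv_nonneg hN _)) ⟨(2 * j, 1), by simp, mul_pos ih ?_⟩
      rw [map_sub, coeff_C_mul, coeff_rescale, coeff_one_tanSeries]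
      simp only [pow_one, mul_one]
      nlinarith
    exact pos_of_mul_pos_left h1 (by positivity)

end CosRatioCoefficients

/-! ### Transfer between formal and convergent power series -/

section PowerSeriesSums

open PowerSeries

theorem hasSum_iff_of_forall_eq {f g : ℕ → ℂ} {a : ℂ} (h : ∀ n, f n = g n) :
    HasSum f a ↔ HasSum g a := by
  rw [funext h]

theorem hasSum_coeff_mul {P Q : PowerSeries ℂ} {z p q : ℂ}
    (hP : HasSum (fun n => coeff n P * z ^ n) p) (hQ : HasSum (fun n => coeff n Q * z ^ n) q) :
    HasSum (fun n => coeff n (P * Q) * z ^ n) (p * q) := by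
  have hP' := hP.summable.norm
  have hQ' := hQ.summable.norm
  have h1 := (summable_norm_sum_mul_antidiagonal_of_summable_norm hP' hQ').of_norm.hasSum
  rw [← tsum_mul_tsum_eq_tsum_sum_antidiagonal_of_summable_norm hP' hQ', hP.tsum_eq, hQ.tsum_eq]
    at h1
  refine (hasSum_iff_of_forall_eq fun n => ?_).mpr h1
  rw [coeff_mul, Finset.sum_mul]
  refine Finset.sum_congr rfl fun i hi => ?_
  rw [← Finset.HasAntidiagonal.mem_antidiagonal.1 hi, pow_add]
  ring

theorem eq_of_hasSum_coeff {P Q : PowerSeries ℂ} {f : ℂ → ℂ} {r : ℝ} (hr : 0 < r)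
    (hP : ∀ z : ℂ, ‖z‖ < r → HasSum (fun n => coeff n P * z ^ n) (f z))
    (hQ : ∀ z : ℂ, ‖z‖ < r → HasSum (fun n => coeff n Q * z ^ n) (f z)) : P = Q := by
  have key : ∀ P : PowerSeries ℂ,
      (∀ z : ℂ, ‖z‖ < r → HasSum (fun n => coeff n P * z ^ n) (f z)) →
      HasFPowerSeriesAt f (FormalMultilinearSeries.ofScalars ℂ fun n => coeff n P) 0 := by
    intro P hP
    rw [hasFPowerSeriesAt_iff]
    filter_upwards [Metric.ball_mem_nhds (0 : ℂ) hr] with z hz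
    have h := hP z (by simpa using hz)
    simpa [FormalMultilinearSeries.coeff_ofScalars, mul_comm] using h
  have h := (key P hP).eq_formalMultilinearSeries (key Q hQ)
  ext n
  have h1 := congrArg (fun s => FormalMultilinearSeries.coeff s n) h
  simpa [FormalMultilinearSeries.coeff_ofScalars] using h1

theorem hasSum_coeff_expSeries (c z : ℂ) :
    HasSum (fun n => coeff n (expSeries c) * z ^ n) (Complex.exp (c * z)) := by
  have h := NormedSpace.expSeries_div_hasSum_exp (c * z)
  rw [← Complex.exp_eq_exp_ℂ] at h
  refine (hasSum_iff_of_forall_eq fun n => ?_).mpr h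
  rw [coeff_expSeries, mul_pow]
  simp
  ring

theorem hasSum_coeff_rescale {P : PowerSeries ℂ} {c z p : ℂ}
    (hP : HasSum (fun n => coeff n P * (c * z) ^ n) p) :
    HasSum (fun n => coeff n (rescale c P) * z ^ n) p := by
  refine (hasSum_iff_of_forall_eq fun n => ?_).mpr hP
  rw [coeff_rescale, mul_pow]
  ring

theorem hasSum_coeff_cos (z : ℂ) :
    HasSum (fun n => coeff n (cos ℂ) * z ^ n) (Complex.cos z) := by
  have h := ((hasSum_coeff_expSeries Complex.I z).add
    (hasSum_coeff_expSeries (-Complex.I) z)).div_const 2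
  have e : Complex.cos z = (Complex.exp (Complex.I * z) + Complex.exp (-Complex.I * z)) / 2 := by
    rw [Complex.cos.eq_1, mul_comm z, neg_mul, mul_comm Complex.I]
    ring_nf
  rw [e]
  refine (hasSum_iff_of_forall_eq fun n => ?_).mpr h
  have h1 := congrArg (coeff n) two_mul_cos
  rw [show (2 : PowerSeries ℂ) = C 2 from (map_ofNat C 2).symm, coeff_C_mul, map_add] at h1
  rw [← add_mul, ← h1]
  ring

end PowerSeriesSums

/-! ### Coefficient asymptotics from the nearest poles -/

section CosRatioAsymptotics

open PowerSeries Filter Topology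

/-- `cos w = (w^2 - π^2 / 4) D(w)` with `D` entire, and without zeros for `|w| < 3 π / 2`. -/
theorem exists_cos_factor : ∃ D : ℂ → ℂ, Differentiable ℂ D ∧
    (∀ w, Complex.cos w = (w ^ 2 - (Real.pi / 2) ^ 2) * D w) ∧
    D (Real.pi / 2) = -(1 / Real.pi) ∧ ∀ w, ‖w‖ < 3 * (Real.pi / 2) → D w ≠ 0 := by
  have hπ : (Real.pi : ℂ) ≠ 0 := by exact_mod_cast Real.pi_ne_zero
  set a : ℂ := Real.pi / 2 with ha
  have ha0 : a ≠ 0 := by simp [ha, hπ]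
  have hdiff : ∀ {f : ℂ → ℂ} (c : ℂ), Differentiable ℂ f → Differentiable ℂ (dslope f c) := by
    intro f c hf
    rw [← differentiableOn_univ] at hf ⊢
    exact (Complex.differentiableOn_dslope univ_mem).2 hf
  set d1 := dslope Complex.cos a with hd1
  have h1 : ∀ w, Complex.cos w = (w - a) * d1 w := by
    intro w
    have h := sub_smul_dslope Complex.cos a w
    rw [smul_eq_mul] at h
    rw [hd1, h, ha, Complex.cos_pi_div_two, sub_zero]
  have hd1a : d1 (-a) = 0 := by
    have h := h1 (-a)
    rw [Complex.cos_neg, ha, Complex.cos_pi_div_two, ← ha] at h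
    have : -a - a ≠ 0 := by
      intro h; apply ha0; linear_combination -h / 2
    exact (mul_eq_zero.1 h.symm).resolve_left this
  have hd1a' : d1 a = -1 := by
    rw [hd1, dslope_same, Complex.deriv_cos, ha, Complex.sin_pi_div_two]
  have h2 : ∀ w, d1 w = (w + a) * dslope d1 (-a) w := by
    intro w
    have h := sub_smul_dslope d1 (-a) w
    rw [smul_eq_mul, hd1a, sub_zero, sub_neg_eq_add] at h
    exact h.symm
  have hD : Differentiable ℂ (dslope d1 (-a)) := hdiff _ (hdiff _ Complex.differentiable_cos)
  have hcos : ∀ w, Complex.cos w = (w ^ 2 - a ^ 2) * dslope d1 (-a) w := by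
    intro w
    rw [h1, h2]; ring
  refine ⟨dslope d1 (-a), hD, hcos, ?_, ?_⟩
  · have h := h2 a
    rw [hd1a'] at h
    rw [eq_neg_iff_add_eq_zero]
    field_simp
    rw [ha] at h ⊢
    linear_combination -h
  · intro w hw h0
    have hc : Complex.cos w = 0 := by rw [hcos, h0, mul_zero]
    -- A zero of the cofactor in this disc would be a zero of cos, hence ±π/2, and then a double
    -- one; but cos and sin have no common zero.
    have hsin : Complex.sin w = 0 := by
      have e : deriv Complex.cos w = 2 * w * dslope d1 (-a) w +
          (w ^ 2 - a ^ 2) * deriv (dslope d1 (-a)) w := by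
        have e1 : HasDerivAt (fun w => (w ^ 2 - a ^ 2) * dslope d1 (-a) w)
            (2 * w * dslope d1 (-a) w + (w ^ 2 - a ^ 2) * deriv (dslope d1 (-a)) w) w := by
          have e2 := ((hasDerivAt_pow 2 w).sub_const (a ^ 2)).mul (hD w).hasDerivAt
          simp only [Nat.cast_ofNat, Nat.add_one_sub_one, pow_one] at e2
          exact e2
        rw [← e1.deriv]
        congr 1
        funext w
        exact hcos w
      obtain ⟨j, hj⟩ := Complex.cos_eq_zero_iff.1 hc
      have hw2 : w ^ 2 - a ^ 2 = 0 := by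
        have hn : ‖w‖ = |(2 * j + 1 : ℤ)| * (Real.pi / 2) := by
          rw [hj, mul_div_assoc, norm_mul]
          congr 1
          · rw [Int.cast_abs, ← Complex.norm_intCast]; push_cast; rfl
          · rw [show (Real.pi : ℂ) / 2 = ((Real.pi / 2 : ℝ) : ℂ) by push_cast; rfl,
              Complex.norm_real, Real.norm_of_nonneg (by positivity)]
        rw [hn] at hw
        have hj3 := lt_of_mul_lt_mul_right hw (by positivity)
        have hj4 : |(2 * j + 1 : ℤ)| < 3 := by exact_mod_cast hj3
        rw [abs_lt] at hj4
        have hj5 : j = 0 ∨ j = -1 := by omega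
        rcases hj5 with rfl | rfl <;> rw [hj, ha] <;> push_cast <;> ring
      rw [Complex.deriv_cos, h0, hw2] at e
      simpa using e
    have := Complex.sin_sq_add_cos_sq w
    rw [hc, hsin] at this
    simp at this

/-- Multiplication by x² - X² makes the partial sums at x telescope, leaving only the two top
coefficients. -/
theorem sum_range_coeff_mul_cosRatio (N x : ℝ) (M : ℕ) :
    ∑ i ∈ Finset.range (M + 2), coeff i ((C (x ^ 2) - X ^ 2) * cosRatio N) * x ^ i =
      x ^ 2 * (coeff M (cosRatio N) * x ^ M + coeff (M + 1) (cosRatio N) * x ^ (M + 1)) := by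
  have h : ∀ i, coeff (i + 2) ((C (x ^ 2) - X ^ 2) * cosRatio N) =
      x ^ 2 * coeff (i + 2) (cosRatio N) - coeff i (cosRatio N) := by
    intro i
    rw [sub_mul, map_sub, coeff_C_mul, coeff_X_pow_mul]
  induction M with
  | zero =>
    rw [Finset.sum_range_succ, Finset.sum_range_one, sub_mul, map_sub, map_sub, coeff_C_mul,
      coeff_C_mul, coeff_X_pow_mul', coeff_X_pow_mul']
    simp [-coeff_zero_eq_constantCoeff]
    ring
  | succ M ih =>
    rw [Finset.sum_range_succ, ih, h]
    ring

/-- With x = π/(2N), the factor x² - z² removes both poles ±x and the product is analytic for |z| <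
3x. Its Taylor series therefore converges at x, and the telescoped partial sums are x² times the
sequence in question, as odd coefficients vanish. -/
theorem tendsto_coeff_even_cosRatio {N : ℝ} (hN : 0 < N) :
    Tendsto (fun j : ℕ => coeff (2 * j) (cosRatio N) * (Real.pi / (2 * N)) ^ (2 * j)) atTop
      (𝓝 (4 * Real.cos (Real.pi / (2 * N)) / Real.pi)) := by
  obtain ⟨D, hD, hcos, hDπ, hD0⟩ := exists_cos_factor
  set x : ℝ := Real.pi / (2 * N) with hx
  have hπ := Real.pi_pos
  have hx0 : 0 < x := by positivity
  have hNx : N * x = Real.pi / 2 := by rw [hx]; field_simp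
  have hNc : (N : ℂ) ≠ 0 := by exact_mod_cast hN.ne'
  -- This is (x² - z²) cos z / cos(Nz), since cos(Nz) = N²(z² - x²) D(Nz).
  set φ : ℂ → ℂ := fun z => -Complex.cos z / (N ^ 2 * D (N * z)) with hφ
  have hDz : ∀ z : ℂ, ‖z‖ < 3 * x → D (N * z) ≠ 0 := by
    intro z hz
    apply hD0
    rw [norm_mul, Complex.norm_real, Real.norm_of_nonneg hN.le, ← hNx]
    nlinarith
  have hdiff : DifferentiableOn ℂ φ (Metric.ball 0 (3 * x)) := by
    intro z hz
    have hz' := hDz z (by simpa using hz)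
    have hd : DifferentiableAt ℂ (fun z : ℂ => D (N * z)) z :=
      (hD _).comp z (by fun_prop)
    refine DifferentiableAt.differentiableWithinAt ?_
    refine DifferentiableAt.div (by fun_prop) (by fun_prop) ?_
    exact mul_ne_zero (pow_ne_zero 2 hNc) hz'
  set P : PowerSeries ℂ := mk fun n => (n.factorial : ℂ)⁻¹ * iteratedDeriv n φ 0 with hP
  have hPsum : ∀ z : ℂ, ‖z‖ < 3 * x → HasSum (fun n => coeff n P * z ^ n) (φ z) := by
    intro z hz
    have h := Complex.hasSum_taylorSeries_on_ball hdiff (z := z) (by simpa using hz)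
    refine (hasSum_iff_of_forall_eq fun n => ?_).mpr h
    rw [hP, coeff_mk, sub_zero, smul_eq_mul, smul_eq_mul]
    ring
  have hprod : P * rescale (N : ℂ) (cos ℂ) = (C ((x : ℂ) ^ 2) - X ^ 2) * cos ℂ := by
    refine eq_of_hasSum_coeff (f := fun z => φ z * Complex.cos (N * z)) (r := 3 * x)
      (by positivity) (fun z hz => ?_) (fun z hz => ?_)
    · exact hasSum_coeff_mul (hPsum z hz) (hasSum_coeff_rescale (hasSum_coeff_cos _))
    · have h1 : HasSum (fun n => coeff n (C ((x : ℂ) ^ 2) - X ^ 2) * z ^ n)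
          ((x : ℂ) ^ 2 - z ^ 2) := by
        have ha := hasSum_single (f := fun n => coeff n (C ((x : ℂ) ^ 2)) * z ^ n) 0
          (fun n hn => by rw [coeff_C, if_neg hn, zero_mul])
        have hb := hasSum_single (f := fun n => coeff n (X ^ 2 : PowerSeries ℂ) * z ^ n) 2
          (fun n hn => by rw [coeff_X_pow, if_neg hn, zero_mul])
        have e : (x : ℂ) ^ 2 - z ^ 2 = coeff 0 (C ((x : ℂ) ^ 2)) * z ^ 0 -
            coeff 2 (X ^ 2 : PowerSeries ℂ) * z ^ 2 := by
          rw [coeff_C, coeff_X_pow, if_pos rfl, if_pos rfl]; ring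
        rw [e]
        refine (hasSum_iff_of_forall_eq fun n => ?_).mpr (ha.sub hb)
        rw [map_sub, sub_mul]
      have h2 := hasSum_coeff_mul h1 (hasSum_coeff_cos z)
      have e : φ z * Complex.cos (N * z) = ((x : ℂ) ^ 2 - z ^ 2) * Complex.cos z := by
        have hz' := hDz z hz
        have hNx' : (N : ℂ) * x = Real.pi / 2 := by exact_mod_cast hNx
        rw [hcos (N * z), ← hNx', hφ]
        field_simp
        ring
      rw [e]
      exact h2
  have hP' : P = PowerSeries.map Complex.ofRealHom ((C (x ^ 2) - X ^ 2) * cosRatio N) := by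
    refine mul_right_cancel₀ (rescale_cos_ne_zero (N : ℂ)) ?_
    rw [hprod, map_mul, map_cosRatio, mul_assoc]
    have := cosRatio_mul_cos (N : ℂ)
    rw [show Complex.ofRealHom N = (N : ℂ) from rfl, this]
    simp
  have hφx : φ x = ((x ^ 2 * (4 * Real.cos x / Real.pi) : ℝ) : ℂ) := by
    have hNx' : (N : ℂ) * x = Real.pi / 2 := by exact_mod_cast hNx
    have hπc : (Real.pi : ℂ) ≠ 0 := by exact_mod_cast hπ.ne'
    rw [hφ]
    simp only
    rw [hNx', hDπ]
    push_cast
    have hxc : (x : ℂ) = Real.pi / (2 * N) := by rw [hx]; push_cast; rfl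
    rw [hxc]
    field_simp
    ring
  have hsum : HasSum (fun n => coeff n ((C (x ^ 2) - X ^ 2) * cosRatio N) * x ^ n)
      (x ^ 2 * (4 * Real.cos x / Real.pi)) := by
    have h := hPsum x (by
      rw [Complex.norm_real, Real.norm_of_nonneg hx0.le]; linarith)
    rw [hφx, hP'] at h
    rw [← Complex.hasSum_ofReal]
    refine (hasSum_iff_of_forall_eq fun n => ?_).mpr h
    rw [coeff_map]
    push_cast
    rfl
  have ht := hsum.tendsto_sum_nat.comp
    (tendsto_atTop_mono (fun j : ℕ => (by omega : j ≤ 2 * j + 2)) tendsto_id)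
  have ht2 := ht.const_mul ((x ^ 2)⁻¹)
  rw [inv_mul_cancel_left₀ (by positivity)] at ht2
  refine ht2.congr fun j => ?_
  simp only [Function.comp]
  rw [sum_range_coeff_mul_cosRatio, inv_mul_cancel_left₀ (by positivity), coeff_odd_cosRatio]
  ring

end CosRatioAsymptotics

/-! ### Convolution with rapidly growing sequences; the comparison sequence -/

section Convolution

open Filter Topology

/-- Dominated convergence for convolutions with a rapidly growing sequence. -/
theorem tendsto_convolution_div {r u : ℕ → ℝ} {w : ℕ → ℕ → ℝ} {v bound : ℕ → ℝ} {D : ℝ}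
    (hr : ∀ n, 0 < r n) (hu : Tendsto (fun n => u n / r n) atTop (𝓝 D))
    (hb : Summable bound)
    (hw : ∀ p m, |w (p + m) m| * r p ≤ bound m * r (p + m))
    (hv : ∀ m, Tendsto (fun n => w n m * r (n - m) / r n) atTop (𝓝 (v m))) :
    Tendsto (fun n => (∑ m ∈ Finset.range (n + 1), u (n - m) * w n m) / r n) atTop
      (𝓝 (D * ∑' m, v m)) := by
  obtain ⟨K, hK⟩ := hu.abs.bddAbove_range
  have hK' : ∀ n, |u n / r n| ≤ K := fun n => hK ⟨n, rfl⟩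
  have hK0 : 0 ≤ K := (abs_nonneg _).trans (hK' 0)
  have hb0 : ∀ m, 0 ≤ bound m := fun m => by
    have := (mul_nonneg (abs_nonneg _) (hr 0).le).trans (hw 0 m)
    exact nonneg_of_mul_nonneg_left this (hr _)
  -- The normalized summand, extended by 0 beyond m = n, so that dominated convergence for series
  -- applies.
  set F : ℕ → ℕ → ℝ := fun n m =>
    if m ≤ n then (u (n - m) / r (n - m)) * (w n m * r (n - m) / r n) else 0 with hF
  have h1 : Tendsto (fun n => ∑' m, F n m) atTop (𝓝 (∑' m, D * v m)) := by
    refine tendsto_tsum_of_dominated_convergence (bound := fun m => K * bound m)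
      (hb.mul_left K) (fun m => ?_) (Eventually.of_forall fun n m => ?_)
    · have h2 : Tendsto (fun n => u (n - m) / r (n - m)) atTop (𝓝 D) :=
        hu.comp (tendsto_sub_atTop_nat m)
      refine (h2.mul (hv m)).congr' ?_
      filter_upwards [eventually_ge_atTop m] with n hn
      simp [hF, hn]
    · simp only [hF]
      split_ifs with hmn
      · obtain ⟨p, rfl⟩ : ∃ p, n = p + m := ⟨n - m, by omega⟩
        rw [Nat.add_sub_cancel, norm_mul, Real.norm_eq_abs, Real.norm_eq_abs]
        refine mul_le_mul (hK' p) ?_ (abs_nonneg _) hK0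
        rw [abs_div, abs_mul, abs_of_pos (hr p), abs_of_pos (hr (p + m)), div_le_iff₀ (hr _)]
        exact hw p m
      · simpa using mul_nonneg hK0 (hb0 m)
  rw [tsum_mul_left] at h1
  refine h1.congr fun n => ?_
  rw [tsum_eq_sum (s := Finset.range (n + 1)), Finset.sum_div]
  · refine Finset.sum_congr rfl fun m hm => ?_
    have hm' : m ≤ n := by rw [Finset.mem_range] at hm; omega
    have := (hr (n - m)).ne'
    simp only [hF, if_pos hm']
    field_simp
  · intro m hm
    rw [Finset.mem_range] at hm
    simp only [hF, if_neg (by omega : ¬ m ≤ n)]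

/-- The comparison sequence `(2n)! / n! κ^n`. -/
noncomputable def growthSeq (κ : ℝ) (n : ℕ) : ℝ := ((2 * n).factorial : ℝ) / n.factorial * κ ^ n

theorem growthSeq_pos {κ : ℝ} (hκ : 0 < κ) (n : ℕ) : 0 < growthSeq κ n := by
  unfold growthSeq; positivity

theorem growthSeq_succ (κ : ℝ) (n : ℕ) :
    growthSeq κ (n + 1) = (4 * n + 2) * κ * growthSeq κ n := by
  unfold growthSeq
  rw [show 2 * (n + 1) = 2 * n + 1 + 1 by ring, Nat.factorial_succ, Nat.factorial_succ,
    Nat.factorial_succ n]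
  push_cast
  field_simp
  ring

/-- Each step multiplies the sequence by (4(p+m)+2)κ, which is at least 2κ(p+1+m). -/
theorem growthSeq_mul_ascFactorial_le {κ : ℝ} (hκ : 0 < κ) (p m : ℕ) :
    growthSeq κ p * (2 * κ) ^ m * ((p + 1).ascFactorial m : ℝ) ≤ growthSeq κ (p + m) := by
  induction m with
  | zero => simp
  | succ m ih =>
    rw [← add_assoc, growthSeq_succ, Nat.ascFactorial_succ]
    calc growthSeq κ p * (2 * κ) ^ (m + 1) * (((p + 1 + m) * (p + 1).ascFactorial m : ℕ) : ℝ)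
        = (2 * (p + 1 + m)) * κ *
            (growthSeq κ p * (2 * κ) ^ m * ((p + 1).ascFactorial m : ℝ)) := by push_cast; ring
      _ ≤ (4 * (p + m : ℕ) + 2) * κ * growthSeq κ (p + m) := by
          refine mul_le_mul ?_ ih ?_ (by positivity)
          · refine mul_le_mul_of_nonneg_right ?_ hκ.le
            push_cast
            linarith [(Nat.cast_nonneg p : (0 : ℝ) ≤ p), (Nat.cast_nonneg m : (0 : ℝ) ≤ m)]
          · have := growthSeq_pos hκ p
            positivity

theorem choose_mul_growthSeq_le {κ : ℝ} (hκ : 0 < κ) (p m : ℕ) :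
    ((p + m).choose m : ℝ) * growthSeq κ p ≤
      (1 / (2 * κ)) ^ m / m.factorial * growthSeq κ (p + m) := by
  have h := growthSeq_mul_ascFactorial_le hκ p m
  rw [Nat.ascFactorial_eq_factorial_mul_choose, Nat.cast_mul] at h
  have hm : (0 : ℝ) < m.factorial := by positivity
  rw [one_div, inv_pow, ← one_div, div_div, div_mul_eq_mul_div, one_mul,
    le_div_iff₀ (by positivity)]
  linarith

/-- Consecutive ratios satisfy r_(n-1)/r_n ~ 1/(4κn); this is used `m` times. -/
theorem tendsto_growthSeq_sub {κ : ℝ} (hκ : 0 < κ) (m : ℕ) :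
    Tendsto (fun n : ℕ => (n : ℝ) ^ m * growthSeq κ (n - m) / growthSeq κ n) atTop
      (𝓝 ((1 / (4 * κ)) ^ m)) := by
  induction m with
  | zero =>
    refine tendsto_const_nhds.congr fun n => ?_
    have := (growthSeq_pos hκ n).ne'
    simp [this]
  | succ m ih =>
    have h1 : Tendsto (fun n : ℕ => (n : ℝ) / ((4 * ((n - (m + 1) : ℕ) : ℝ) + 2) * κ)) atTop
        (𝓝 (1 / (4 * κ))) := by
      have h2 : Tendsto (fun n : ℕ => 1 / ((4 - (4 * m + 2) / (n : ℝ)) * κ)) atTop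
          (𝓝 (1 / ((4 - 0) * κ))) := by
        refine tendsto_const_nhds.div ((tendsto_const_nhds.sub
          (tendsto_const_div_atTop_nhds_zero_nat _)).mul_const κ) ?_
        positivity
      rw [sub_zero] at h2
      refine h2.congr' ?_
      filter_upwards [eventually_ge_atTop (m + 1)] with n hn
      have hn0 : (n : ℝ) ≠ 0 := by
        have : n ≠ 0 := by omega
        exact_mod_cast this
      have e : 4 * ((n - (m + 1) : ℕ) : ℝ) + 2 = n * (4 - (4 * m + 2) / n) := by
        rw [Nat.cast_sub hn]; push_cast; field_simp; ring
      rw [e, mul_assoc, div_mul_cancel_left₀ hn0, one_div]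
    rw [pow_succ']
    refine (h1.mul ih).congr' ?_
    filter_upwards [eventually_ge_atTop (m + 1)] with n hn
    have e : n - m = (n - (m + 1)) + 1 := by omega
    rw [e, growthSeq_succ]
    have := (growthSeq_pos hκ n).ne'
    have h3 : (4 * ((n - (m + 1) : ℕ) : ℝ) + 2) ≠ 0 := by positivity
    field_simp
    ring

theorem tendsto_growthSeq_sub_of_pos {κ : ℝ} (hκ : 0 < κ) {m : ℕ} (hm : m ≠ 0) :
    Tendsto (fun n : ℕ => growthSeq κ (n - m) / growthSeq κ n) atTop (𝓝 0) := by
  have h1 : Tendsto (fun n : ℕ => ((n : ℝ) ^ m)⁻¹) atTop (𝓝 0) :=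
    ((tendsto_pow_atTop hm).comp tendsto_natCast_atTop_atTop).inv_tendsto_atTop
  have h2 := (tendsto_growthSeq_sub hκ m).mul h1
  rw [mul_zero] at h2
  refine h2.congr' ?_
  filter_upwards [eventually_gt_atTop 0] with n hn
  have : (n : ℝ) ≠ 0 := by positivity
  field_simp

/-- Up to its first terms this is s_n²/s_(2n) for the Stirling sequence s_n → √π. -/
theorem tendsto_four_pow_div_centralBinom :
    Tendsto (fun n : ℕ => (4 : ℝ) ^ n * (n.factorial : ℝ) ^ 2 / ((2 * n).factorial * √n)) atTop
      (𝓝 √Real.pi) := by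
  have hs := Stirling.tendsto_stirlingSeq_sqrt_pi
  have h2 : Tendsto (fun n : ℕ => 2 * n) atTop atTop :=
    tendsto_atTop_mono (fun n => by simp only [id]; omega) tendsto_id
  have hπ : √Real.pi ≠ 0 := (Real.sqrt_pos.2 Real.pi_pos).ne'
  have h := (hs.pow 2).div (hs.comp h2) hπ
  rw [sq, mul_div_cancel_right₀ _ hπ] at h
  refine h.congr' ?_
  filter_upwards [eventually_gt_atTop 0] with n hn
  have hn' : (0 : ℝ) < n := by exact_mod_cast hn
  have hsq : √(n : ℝ) ^ 2 = n := Real.sq_sqrt hn'.le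
  have hsn : √(n : ℝ) ≠ 0 := (Real.sqrt_pos.2 hn').ne'
  simp only [Pi.div_apply, Function.comp, Stirling.stirlingSeq]
  have e1 : √(2 * ((2 * n : ℕ) : ℝ)) = 2 * √n := by
    rw [show (2 * ((2 * n : ℕ) : ℝ)) = 2 ^ 2 * n by push_cast; ring,
      Real.sqrt_mul (by norm_num), Real.sqrt_sq (by norm_num)]
  have e2 : √(2 * (n : ℝ)) ^ 2 = 2 * n := Real.sq_sqrt (by positivity)
  have e3 : (((2 * n : ℕ) : ℝ) / Real.exp 1) ^ (2 * n) =
      4 ^ n * ((n / Real.exp 1) ^ n) ^ 2 := by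
    push_cast
    rw [mul_div_assoc, mul_pow, pow_mul, pow_mul' (_ / _)]
    norm_num
  rw [div_pow, mul_pow, e1, e2, e3]
  have : ((n / Real.exp 1) ^ n : ℝ) ≠ 0 := by positivity
  field_simp
  rw [hsq]

end Convolution

/-! ### Coefficients of powers of -log(1-X)/X -/

section PowerCoefficients

open PowerSeries Filter Topology

theorem coeff_negLogDivX_pow_nonneg (p m : ℕ) : 0 ≤ coeff m (negLogDivX ^ p) := by
  induction p generalizing m with
  | zero => rw [pow_zero, coeff_one]; split_ifs <;> norm_num
  | succ p ih =>
    rw [pow_succ, coeff_mul]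
    refine Finset.sum_nonneg fun i _ => mul_nonneg (ih _) ?_
    rw [negLogDivX, coeff_mk]; positivity

/-- The series -log(1-X)/X is dominated coefficientwise by 1/(1-X), and one spare factor 1/(1-X) is
allowed. -/
theorem coeff_negLogDivX_pow_le (p m : ℕ) :
    coeff m (negLogDivX ^ p) ≤ ((p + m).choose m : ℝ) := by
  have h : coeff m (negLogDivX ^ p) ≤ coeff m ((mk 1 : PowerSeries ℝ) ^ (p + 1)) := by
    induction p generalizing m with
    | zero =>
      rw [pow_zero, coeff_one, zero_add, pow_one, coeff_mk]
      split_ifs <;> norm_num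
    | succ p ih =>
      rw [pow_succ, pow_succ _ (p + 1), coeff_mul, coeff_mul]
      refine Finset.sum_le_sum fun i _ => mul_le_mul (ih _) ?_ ?_ ?_
      · rw [negLogDivX, coeff_mk, coeff_mk]
        exact inv_le_one_of_one_le₀ (by simp)
      · rw [negLogDivX, coeff_mk]; positivity
      · exact (coeff_negLogDivX_pow_nonneg _ _).trans (ih _)
  rw [mk_one_pow_eq_mk_choose_add, coeff_mk, Nat.choose_symm_add] at h
  exact h

theorem tendsto_choose_div_pow (j : ℕ) :
    Tendsto (fun p : ℕ => (p.choose j : ℝ) / (p : ℝ) ^ j) atTop (𝓝 (1 / j.factorial)) := by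
  have h := isEquivalent_choose j
  have hne : ∀ᶠ p : ℕ in atTop, ((p : ℝ) ^ j / j.factorial) ≠ 0 := by
    filter_upwards [eventually_gt_atTop 0] with p hp
    positivity
  have h1 := ((Asymptotics.isEquivalent_iff_tendsto_one hne).1 h).mul_const (1 / (j.factorial : ℝ))
  rw [one_mul] at h1
  refine h1.congr' ?_
  filter_upwards [eventually_gt_atTop 0] with p hp
  simp only [Pi.div_apply]
  field_simp

/-- Write the series as 1 + h with h = X/2 + ⋯ and expand (1+h)^p. Only h^j with j ≤ m reach degree
`m`, and the largest binomial p^m/m! comes with (1/2)^m. -/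
theorem tendsto_coeff_negLogDivX_pow (m : ℕ) :
    Tendsto (fun p : ℕ => coeff m (negLogDivX ^ p) / (p : ℝ) ^ m) atTop
      (𝓝 ((1 / 2) ^ m / m.factorial)) := by
  have hX : (X : PowerSeries ℝ) ∣ negLogDivX - 1 := by
    rw [X_dvd_iff, map_sub, ← coeff_zero_eq_constantCoeff_apply, negLogDivX, coeff_mk]; simp
  have hexp : ∀ p : ℕ, coeff m (negLogDivX ^ p) =
      ∑ j ∈ Finset.range (m + 1), (p.choose j : ℝ) * coeff m ((negLogDivX - 1) ^ j) := by
    intro p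
    have h1 : negLogDivX ^ p = ∑ j ∈ Finset.range (p + 1),
        C (p.choose j : ℝ) * (negLogDivX - 1) ^ j := by
      conv_lhs => rw [← sub_add_cancel negLogDivX 1, add_pow]
      refine Finset.sum_congr rfl fun j _ => ?_
      rw [one_pow, mul_one, map_natCast, mul_comm]
    rw [h1, map_sum]
    simp only [coeff_C_mul]
    have hz1 : ∀ j, p < j → (p.choose j : ℝ) * coeff m ((negLogDivX - 1) ^ j) = 0 := by
      intro j hj; rw [Nat.choose_eq_zero_of_lt hj]; simp
    have hz2 : ∀ j, m < j → (p.choose j : ℝ) * coeff m ((negLogDivX - 1) ^ j) = 0 := by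
      intro j hj; rw [X_pow_dvd_iff.1 (pow_dvd_pow_of_dvd hX j) m hj, mul_zero]
    rcases le_total p m with h | h
    · refine Finset.sum_subset (Finset.range_subset_range.2 (by omega)) fun j _ hj => hz1 j ?_
      rw [Finset.mem_range] at hj; omega
    · refine (Finset.sum_subset (Finset.range_subset_range.2 (by omega)) fun j _ hj => hz2 j ?_).symm
      rw [Finset.mem_range] at hj; omega
  have hlead : coeff m ((negLogDivX - 1) ^ m) = (1 / 2) ^ m := by
    obtain ⟨g, hg⟩ := hX
    have h1 : coeff 1 (negLogDivX - 1) = 1 / 2 := by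
      rw [map_sub, negLogDivX, coeff_mk, coeff_one]; norm_num
    rw [hg, show coeff 1 (X * g) = coeff 0 g from coeff_succ_X_mul 0 g,
      coeff_zero_eq_constantCoeff_apply] at h1
    have := coeff_X_pow_mul (g ^ m) m 0
    rw [zero_add] at this
    rw [hg, mul_pow, this, coeff_zero_eq_constantCoeff_apply, map_pow, h1]
  have hlim : Tendsto (fun p : ℕ => ∑ j ∈ Finset.range (m + 1),
      (p.choose j : ℝ) / (p : ℝ) ^ m * coeff m ((negLogDivX - 1) ^ j)) atTop
      (𝓝 (∑ j ∈ Finset.range (m + 1),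
        (if j = m then 1 / (m.factorial : ℝ) else 0) * coeff m ((negLogDivX - 1) ^ j))) := by
    refine tendsto_finsetSum _ fun j hj => Tendsto.mul_const _ ?_
    rw [Finset.mem_range] at hj
    split_ifs with hjm
    · rw [hjm]; exact tendsto_choose_div_pow m
    · have hlt : m - j ≠ 0 := by omega
      have h1 : Tendsto (fun n : ℕ => ((n : ℝ) ^ (m - j))⁻¹) atTop (𝓝 0) :=
        ((tendsto_pow_atTop hlt).comp tendsto_natCast_atTop_atTop).inv_tendsto_atTop
      have h2 := (tendsto_choose_div_pow j).mul h1
      rw [mul_zero] at h2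
      refine h2.congr fun p => ?_
      rw [← div_eq_mul_inv, div_div, ← pow_add, show j + (m - j) = m by omega]
  have e : ∑ j ∈ Finset.range (m + 1),
        (if j = m then 1 / (m.factorial : ℝ) else 0) * coeff m ((negLogDivX - 1) ^ j) =
      (1 / 2) ^ m / m.factorial := by
    rw [Finset.sum_eq_single m]
    · rw [if_pos rfl, hlead]; ring
    · intro j _ hj; rw [if_neg hj, zero_mul]
    · simp
  rw [e] at hlim
  refine hlim.congr fun p => ?_
  rw [hexp, Finset.sum_div]
  exact Finset.sum_congr rfl fun j _ => by ring

theorem tendsto_coeff_negLogDivX_pow_sub (m : ℕ) :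
    Tendsto (fun n : ℕ => coeff m (negLogDivX ^ (n - m)) / (n : ℝ) ^ m) atTop
      (𝓝 ((1 / 2) ^ m / m.factorial)) := by
  have h1 := (tendsto_coeff_negLogDivX_pow m).comp (tendsto_sub_atTop_nat m)
  have h2 : Tendsto (fun n : ℕ => (1 - (m : ℝ) / n) ^ m) atTop (𝓝 ((1 - 0) ^ m)) :=
    (tendsto_const_nhds.sub (tendsto_const_div_atTop_nhds_zero_nat _)).pow m
  have h3 := h1.mul h2
  rw [sub_zero, one_pow, mul_one] at h3
  refine h3.congr' ?_
  filter_upwards [eventually_gt_atTop m] with n hn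
  have hn0 : (n : ℝ) ≠ 0 := by
    have : n ≠ 0 := by omega
    exact_mod_cast this
  have hnm : ((n - m : ℕ) : ℝ) ≠ 0 := by
    have : n - m ≠ 0 := by omega
    exact_mod_cast this
  have e : 1 - (m : ℝ) / n = ((n - m : ℕ) : ℝ) / n := by
    rw [Nat.cast_sub hn.le]; field_simp
  simp only [Function.comp]
  rw [e, div_pow]
  field_simp

end PowerCoefficients

/-! ### Assembling positivity and the limit -/

section Coefficients

open PowerSeries Filter Topology

theorem coeff_thetaExpansion (k n : ℕ) :
    coeff n (thetaExpansion k) = ∑ m ∈ Finset.range (n + 1),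
      coeff (n - m) (gaussTransform (1 / (4 * (2 * (k : ℝ) + 1))) (cosRatio (2 * (k : ℝ) + 1))) *
        (((k : ℝ) ^ 2 / (2 * k + 1)) ^ m / m.factorial) := by
  rw [thetaExpansion, coeff_mul, Finset.Nat.sum_antidiagonal_eq_sum_range_succ_mk]
  refine Finset.sum_congr rfl fun m _ => ?_
  rw [coeff_expSeries]
  simp
  ring

theorem coeff_gaussTransform_cosRatio_pos (k n : ℕ) (hk : 1 ≤ k) :
    0 < coeff n (gaussTransform (1 / (4 * (2 * (k : ℝ) + 1))) (cosRatio (2 * (k : ℝ) + 1))) := by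
  have hk' : (1 : ℝ) ≤ k := by exact_mod_cast hk
  rw [gaussTransform, coeff_mk]
  refine mul_pos (mul_pos ?_ (by positivity)) (coeff_even_cosRatio_pos (by linarith) n)
  simp
  positivity

theorem coeff_thetaExpansion_pos (k n : ℕ) (hk : 1 ≤ k) : 0 < coeff n (thetaExpansion k) := by
  rw [coeff_thetaExpansion]
  refine Finset.sum_pos' (fun m _ => mul_nonneg (coeff_gaussTransform_cosRatio_pos k _ hk).le
    (by positivity)) ⟨0, by simp, ?_⟩
  simpa using coeff_gaussTransform_cosRatio_pos k n hk

/-- The pole contributes (2N/π)^(2n) and the transform (2n)!/n! (1/(4N))^n; together they give κ =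
N/π². -/
theorem tendsto_coeff_gaussTransform_cosRatio (k : ℕ) :
    Tendsto (fun n => coeff n (gaussTransform (1 / (4 * (2 * (k : ℝ) + 1)))
      (cosRatio (2 * (k : ℝ) + 1))) / growthSeq ((2 * (k : ℝ) + 1) / Real.pi ^ 2) n) atTop
      (𝓝 (4 * Real.cos (Real.pi / (2 * (2 * (k : ℝ) + 1))) / Real.pi)) := by
  have hN : (0 : ℝ) < 2 * k + 1 := by positivity
  have hπ := Real.pi_pos
  refine (tendsto_coeff_even_cosRatio hN).congr fun n => ?_
  rw [gaussTransform, coeff_mk, growthSeq]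
  have h1 : (Real.pi / (2 * (2 * (k : ℝ) + 1))) ^ (2 * n) =
      (1 / (4 * (2 * (k : ℝ) + 1))) ^ n / ((2 * (k : ℝ) + 1) / Real.pi ^ 2) ^ n := by
    rw [pow_mul, ← div_pow]
    congr 1
    field_simp
    ring
  have h2 : algebraMap ℚ ℝ ((2 * n).factorial / n.factorial) =
      ((2 * n).factorial : ℝ) / n.factorial := by simp
  rw [h1, h2]
  have h3 : ((2 * n).factorial : ℝ) ≠ 0 := by positivity
  have h4 : (n.factorial : ℝ) ≠ 0 := by positivity
  have h5 : (((2 * (k : ℝ) + 1) / Real.pi ^ 2) ^ n) ≠ 0 := by positivity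
  rw [mul_assoc (_ / _), mul_div_mul_left _ _ (div_ne_zero h3 h4)]
  ring

/-- The factor e^(k²t/N) leaves the limit unchanged: r_(n-m)/r_n → 0 for m > 0, so only m = 0
survives. -/
theorem tendsto_coeff_thetaExpansion (k : ℕ) :
    Tendsto (fun n => coeff n (thetaExpansion k) /
      growthSeq ((2 * (k : ℝ) + 1) / Real.pi ^ 2) n) atTop
      (𝓝 (4 * Real.cos (Real.pi / (2 * (2 * (k : ℝ) + 1))) / Real.pi)) := by
  set κ : ℝ := (2 * (k : ℝ) + 1) / Real.pi ^ 2 with hκdef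
  have hπ := Real.pi_pos
  have hκ : 0 < κ := by positivity
  set β : ℝ := (k : ℝ) ^ 2 / (2 * k + 1) with hβdef
  have hβ : 0 ≤ β := by positivity
  have h := tendsto_convolution_div (w := fun _ m => β ^ m / m.factorial)
    (v := fun m => if m = 0 then 1 else 0) (bound := fun m => (β / (2 * κ)) ^ m / m.factorial)
    (growthSeq_pos hκ) (tendsto_coeff_gaussTransform_cosRatio k)
    (Real.summable_pow_div_factorial _) (fun p m => ?_) (fun m => ?_)
  · rw [tsum_ite_eq, mul_one] at h
    refine h.congr fun n => ?_
    rw [coeff_thetaExpansion]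
  · have h1 := choose_mul_growthSeq_le hκ p m
    have h2 : (1 : ℝ) ≤ (p + m).choose m := by
      exact_mod_cast Nat.choose_pos (Nat.le_add_left m p)
    have h3 : (1 : ℝ) ≤ m.factorial := by exact_mod_cast m.factorial_pos
    have h4 := growthSeq_pos hκ p
    have h5 := growthSeq_pos hκ (p + m)
    rw [abs_of_nonneg (by positivity)]
    calc β ^ m / m.factorial * growthSeq κ p
        ≤ β ^ m / 1 * (((p + m).choose m : ℝ) * growthSeq κ p) := by
          refine mul_le_mul (div_le_div_of_nonneg_left (by positivity) one_pos h3)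
            (le_mul_of_one_le_left h4.le h2) h4.le (by positivity)
      _ ≤ β ^ m / 1 * ((1 / (2 * κ)) ^ m / m.factorial * growthSeq κ (p + m)) := by gcongr
      _ = (β / (2 * κ)) ^ m / m.factorial * growthSeq κ (p + m) := by
          rw [div_pow, div_pow, one_pow]; ring
  · split_ifs with hm
    · subst hm
      refine tendsto_const_nhds.congr fun n => ?_
      have := (growthSeq_pos hκ n).ne'
      simp [this]
    · have h1 := (tendsto_growthSeq_sub_of_pos hκ hm).const_mul (β ^ m / m.factorial)
      rw [mul_zero] at h1
      exact h1.congr fun n => by rw [mul_div_assoc]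

theorem xiG_eq_convolution (k n : ℕ) (hk : 1 ≤ k) :
    (xiG k n : ℝ) = ∑ m ∈ Finset.range (n + 1),
      coeff (n - m) (thetaExpansion k) * coeff m (negLogDivX ^ (n - m)) := by
  rw [xiG_eq_sum k n hk, ← Finset.sum_flip]
  refine Finset.sum_congr rfl fun m hm => ?_
  have h := coeff_negLog_pow (n - m) m
  rw [Finset.mem_range] at hm
  rw [show m + (n - m) = n by omega] at h
  rw [h]

theorem xiG_pos (k n : ℕ) (hk : 1 ≤ k) : 0 < xiG k n := by
  have h : (0 : ℝ) < xiG k n := by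
    rw [xiG_eq_convolution k n hk]
    refine Finset.sum_pos' (fun m _ => mul_nonneg (coeff_thetaExpansion_pos k _ hk).le
      (coeff_negLogDivX_pow_nonneg _ _)) ⟨0, by simp, ?_⟩
    refine mul_pos (coeff_thetaExpansion_pos k _ hk) ?_
    rw [coeff_zero_eq_constantCoeff_apply, map_pow, ← coeff_zero_eq_constantCoeff_apply,
      negLogDivX, coeff_mk]
    simp
  exact_mod_cast h

/-- Here the weights grow like (n/2)^m/m!, exactly compensating r_(n-m)/r_n ~ (4κn)^(-m). Every `m`
contributes (1/(8κ))^m/m!, which sums to the exponential. -/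
theorem tendsto_xiG_div_growthSeq (k : ℕ) (hk : 1 ≤ k) :
    Tendsto (fun n => (xiG k n : ℝ) / growthSeq ((2 * (k : ℝ) + 1) / Real.pi ^ 2) n) atTop
      (𝓝 (4 * Real.cos (Real.pi / (2 * (2 * (k : ℝ) + 1))) / Real.pi *
        Real.exp (Real.pi ^ 2 / (8 * (2 * (k : ℝ) + 1))))) := by
  set κ : ℝ := (2 * (k : ℝ) + 1) / Real.pi ^ 2 with hκdef
  have hπ := Real.pi_pos
  have hκ : 0 < κ := by positivity
  have h := tendsto_convolution_div (w := fun n m => coeff m (negLogDivX ^ (n - m)))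
    (v := fun m => (1 / (8 * κ)) ^ m / m.factorial)
    (bound := fun m => (1 / (2 * κ)) ^ m / m.factorial)
    (growthSeq_pos hκ) (tendsto_coeff_thetaExpansion k)
    (Real.summable_pow_div_factorial _) (fun p m => ?_) (fun m => ?_)
  · have e : ∑' m : ℕ, (1 / (8 * κ)) ^ m / m.factorial =
        Real.exp (Real.pi ^ 2 / (8 * (2 * (k : ℝ) + 1))) := by
      have h1 := (NormedSpace.expSeries_div_hasSum_exp (1 / (8 * κ))).tsum_eq
      rw [← Real.exp_eq_exp_ℝ] at h1
      rw [h1]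
      congr 1
      rw [hκdef]
      field_simp
    rw [e] at h
    refine h.congr fun n => ?_
    rw [xiG_eq_convolution k n hk]
  · rw [Nat.add_sub_cancel, abs_of_nonneg (coeff_negLogDivX_pow_nonneg _ _)]
    exact (mul_le_mul_of_nonneg_right (coeff_negLogDivX_pow_le p m) (growthSeq_pos hκ p).le).trans
      (choose_mul_growthSeq_le hκ p m)
  · have h1 := (tendsto_coeff_negLogDivX_pow_sub m).mul (tendsto_growthSeq_sub hκ m)
    have e : (1 / 2 : ℝ) ^ m / m.factorial * (1 / (4 * κ)) ^ m =
        (1 / (8 * κ)) ^ m / m.factorial := by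
      rw [div_mul_eq_mul_div, ← mul_pow]
      congr 2
      field_simp
      norm_num
    rw [e] at h1
    refine h1.congr' ?_
    filter_upwards [eventually_gt_atTop 0] with n hn
    have : (n : ℝ) ≠ 0 := by positivity
    field_simp

end Coefficients

theorem corollary3p5 (k : ℕ) (hk : 1 ≤ k) :
    Asymptotics.IsEquivalent Filter.atTop
      (fun n : ℕ => (xiG k n : ℝ))
      (fun n : ℕ =>
        Real.cos (Real.pi / (2 * (2 * (k : ℝ) + 1))) * 2 ^ (2 * n + 2) * (Nat.factorial n : ℝ) /
            (Real.pi ^ (3 / 2 : ℝ) * Real.sqrt (n : ℝ)) *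
          ((2 * (k : ℝ) + 1) / Real.pi ^ 2) ^ n *
          Real.exp (Real.pi ^ 2 / (8 * (2 * (k : ℝ) + 1)))) ∧
    ∀ n : ℕ, 0 < xiG k n := by
  refine ⟨?_, fun n => xiG_pos k n hk⟩
  have hπ := Real.pi_pos
  have hk' : (1 : ℝ) ≤ k := by exact_mod_cast hk
  have hκ : 0 < (2 * (k : ℝ) + 1) / Real.pi ^ 2 := by positivity
  have hcos : 0 < Real.cos (Real.pi / (2 * (2 * (k : ℝ) + 1))) := by
    have h0 : 0 < Real.pi / (2 * (2 * (k : ℝ) + 1)) := by positivity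
    refine Real.cos_pos_of_mem_Ioo ⟨by linarith, ?_⟩
    exact div_lt_div_of_pos_left hπ two_pos (by linarith)
  have h1 := tendsto_xiG_div_growthSeq k hk
  have h2 := tendsto_four_pow_div_centralBinom
  set c := Real.cos (Real.pi / (2 * (2 * (k : ℝ) + 1)))
  set κ := (2 * (k : ℝ) + 1) / Real.pi ^ 2
  set E := Real.exp (Real.pi ^ 2 / (8 * (2 * (k : ℝ) + 1)))
  have hE : 0 < E := Real.exp_pos _
  have hsπ : 0 < √Real.pi := Real.sqrt_pos.2 hπ
  have hpow : Real.pi ^ (3 / 2 : ℝ) = Real.pi * √Real.pi := by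
    rw [show (3 / 2 : ℝ) = 1 + 1 / 2 by norm_num, Real.rpow_add hπ, Real.rpow_one,
      Real.sqrt_eq_rpow]
  -- Dividing by the Stirling limit replaces (2n)!/n! by 4^n n!/√n; the constant is chosen so that
  -- the quotient tends to 1.
  have h3 := h1.div (h2.const_mul (4 * c * E / (Real.pi * √Real.pi))) (by positivity)
  have e : 4 * c / Real.pi * E / (4 * c * E / (Real.pi * √Real.pi) * √Real.pi) = 1 := by
    field_simp
  rw [e] at h3
  have hne : ∀ᶠ n : ℕ in Filter.atTop, c * 2 ^ (2 * n + 2) * (Nat.factorial n : ℝ) /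
      (Real.pi ^ (3 / 2 : ℝ) * √(n : ℝ)) * κ ^ n * E ≠ 0 := by
    filter_upwards [Filter.eventually_gt_atTop 0] with n hn
    positivity
  rw [Asymptotics.isEquivalent_iff_tendsto_one hne]
  refine h3.congr' ?_
  filter_upwards [Filter.eventually_gt_atTop 0] with n hn
  have hsn : √(n : ℝ) ≠ 0 := by positivity
  have h4 : ((2 * n).factorial : ℝ) ≠ 0 := by positivity
  have h5 : (n.factorial : ℝ) ≠ 0 := by positivity
  have h6 : κ ^ n ≠ 0 := by positivity
  simp only [Pi.div_apply]
  rw [hpow, growthSeq, pow_add, pow_mul]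
  norm_num
  field_simp
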